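/- Let $\mathcal H_A,\mathcal H_B,\mathcal H_C$ be finite-dimensional complex Hilbert spaces and let $\psi\in\mathcal H_A\otimes\mathcal H_B\otimes\mathcal H_C$ be a unit vector. Let $\mathrm{EPR}_{AB}$ be the state with state vector $\frac{1}{\sqrt2}(|000\rangle+|110\rangle)\in\mathbb C^2\otimes\mathbb C^2\otimes\mathbb C$. For positive operators $\rho,\sigma$ on (possibly different) tripartite spaces write $\rho\to\sigma$ if there is a trace-nonincreasing (finite-round) tripartite LOCC channel $\Lambda$ with $\Lambda(\rho)=\sigma$, and $\rho\to_{\epsilon}\sigma$ if there is a trace-preserving LOCC channel $\Lambda$ with $F(\Lambda(\rho),\sigma)\ge 1-\epsilon$, where $F(\sigma,\tau)=\|\sqrt\sigma\sqrt\tau\|_1^2$. Tensor powers are regarded as tripartite by grouping the $A$, $B$ and $C$ factors, respectively, and $\log$ is to base $2$. For $r>0$ let $$R(\rho\to\sigma,r)=\sup\Big\{\limsup_{m\to\infty}\tfrac{n_m}{m}\Big\},\qquad R_F(\rho\to\sigma,r)=\sup\Big\{\limsup_{m\to\infty}\tfrac{n_m}{m}\Big\},$$ where the first supremum is over all sequences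 $(n_m)\in\mathbb N^{\mathbb N}$ for which there is $(p_m)\in(0,1)^{\mathbb N}$ with $\liminf_{m\to\infty}-\frac1m\log(1-p_m)\ge r$ and $\rho^{\otimes m}\to p_m\,\sigma^{\otimes n_m}$ for all $m$, and the second is over all $(n_m)\in\mathbb N^{\mathbb N}$ for which there is $(\epsilon_m)\in(0,1)^{\mathbb N}$ with $\liminf_{m\to\infty}-\frac1m\log\epsilon_m\ge r$ and $\rho^{\otimes m}\to_{\epsilon_m}\sigma^{\otimes n_m}$ for all $m$ (both suprema taken in $[-\infty,\infty]$). Then for every such $\psi$ and every $r>0$, $$R(|\psi\rangle\langle\psi|\to\mathrm{EPR}_{AB},r)=R_F(|\psi\rangle\langle\psi|\to\mathrm{EPR}_{AB},r).$$ -/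

import Mathlib

open scoped Kronecker ComplexOrder

noncomputable section

namespace EPRDistill

/-- A tripartite finite-dimensional system `ℂ^A ⊗ ℂ^B ⊗ ℂ^C`, given by finite index sets of
orthonormal bases of the three local Hilbert spaces. -/
structure System where
  A : Type
  B : Type
  C : Type
  [fintypeA : Fintype A]
  [fintypeB : Fintype B]
  [fintypeC : Fintype C]
  [decEqA : DecidableEq A]
  [decEqB : DecidableEq B]
  [decEqC : DecidableEq C]

attribute [instance] System.fintypeA System.fintypeB System.fintypeC
attribute [instance] System.decEqA System.decEqB System.decEqC

namespace System

/-- Index set of the product basis of `ℂ^A ⊗ ℂ^B ⊗ ℂ^C`. -/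
abbrev Idx (S : System) : Type := S.A × S.B × S.C

/-- Operators on `ℂ^A ⊗ ℂ^B ⊗ ℂ^C`. -/
abbrev Op (S : System) : Type := Matrix S.Idx S.Idx ℂ

/-- Replace the local space of party `A`. -/
abbrev withA (S : System) (X : Type) [Fintype X] [DecidableEq X] : System := ⟨X, S.B, S.C⟩

/-- Replace the local space of party `B`. -/
abbrev withB (S : System) (X : Type) [Fintype X] [DecidableEq X] : System := ⟨S.A, X, S.C⟩

/-- Replace the local space of party `C`. -/
abbrev withC (S : System) (X : Type) [Fintype X] [DecidableEq X] : System := ⟨S.A, S.B, X⟩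

/-- `m` copies of a system, party `A` holding all the `A` parts, and so on. -/
abbrev pow (S : System) (m : ℕ) : System := ⟨Fin m → S.A, Fin m → S.B, Fin m → S.C⟩

end System

/-- The tensor power `ρ^{⊗m}` as an operator on `m` copies of the system. -/
def tensorPow {S : System} (ρ : S.Op) (m : ℕ) : (S.pow m).Op :=
  Matrix.of fun x y =>
    ∏ k : Fin m, ρ (x.1 k, x.2.1 k, x.2.2 k) (y.1 k, y.2.1 k, y.2.2 k)

/-- The rank one operator `|ψ⟩⟨ψ|`. -/
def ketbra {ι : Type} (ψ : EuclideanSpace ℂ ι) : Matrix ι ι ℂ :=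
  Matrix.of fun x y => ψ x * star (ψ y)

/-- The map `X ↦ M X M†`. -/
def conjBy {ι κ : Type} [Fintype ι] (M : Matrix κ ι ℂ) :
    Matrix ι ι ℂ →ₗ[ℂ] Matrix κ κ ℂ where
  toFun X := M * X * M.conjTranspose
  map_add' X Y := by rw [Matrix.mul_add, Matrix.add_mul]
  map_smul' z X := by simp

/-- A (trace-nonincreasing) quantum instrument on `ℂ^α` with finitely many outcomes `j`:
the outcome `j` is accompanied by the completely positive map `X ↦ ∑ l, K j l X (K j l)†` into
the operators on `ℂ^(Out j)`, and `∑ j, ∑ l, (K j l)† (K j l) ≤ 1`. -/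
structure LocalInstrument (α : Type) [Fintype α] [DecidableEq α] where
  Outcome : Type
  [fintypeOutcome : Fintype Outcome]
  Label : Outcome → Type
  [fintypeLabel : ∀ j, Fintype (Label j)]
  Out : Outcome → Type
  [fintypeOut : ∀ j, Fintype (Out j)]
  [decEqOut : ∀ j, DecidableEq (Out j)]
  K : ∀ j, Label j → Matrix (Out j) α ℂ
  sum_le_one : (1 - ∑ j, ∑ l, (K j l).conjTranspose * K j l).PosSemidef

attribute [instance] LocalInstrument.fintypeOutcome LocalInstrument.fintypeLabel
attribute [instance] LocalInstrument.fintypeOut LocalInstrument.decEqOut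

/-- The branch of outcome `j` when party `A` applies the instrument `I` to its subsystem. -/
def branchA {S : System} (I : LocalInstrument S.A) (j : I.Outcome) :
    S.Op →ₗ[ℂ] (S.withA (I.Out j)).Op :=
  ∑ l, conjBy (I.K j l ⊗ₖ ((1 : Matrix S.B S.B ℂ) ⊗ₖ (1 : Matrix S.C S.C ℂ)))

/-- The branch of outcome `j` when party `B` applies the instrument `I` to its subsystem. -/
def branchB {S : System} (I : LocalInstrument S.B) (j : I.Outcome) :
    S.Op →ₗ[ℂ] (S.withB (I.Out j)).Op :=
  ∑ l, conjBy ((1 : Matrix S.A S.A ℂ) ⊗ₖ (I.K j l ⊗ₖ (1 : Matrix S.C S.C ℂ)))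

/-- The branch of outcome `j` when party `C` applies the instrument `I` to its subsystem. -/
def branchC {S : System} (I : LocalInstrument S.C) (j : I.Outcome) :
    S.Op →ₗ[ℂ] (S.withC (I.Out j)).Op :=
  ∑ l, conjBy ((1 : Matrix S.A S.A ℂ) ⊗ₖ ((1 : Matrix S.B S.B ℂ) ⊗ₖ I.K j l))

/-- Trace-nonincreasing LOCC channels (finitely many rounds): either nothing is done, or one of
the parties applies a local instrument and broadcasts the outcome `j`, and the parties go on with
an LOCC protocol that may depend on `j`; at the end the classical record is forgotten. Weight
missing from an instrument (`∑ K† K ≠ 1`) is the failure of the protocol in that round. -/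
inductive IsLOCC : ∀ {S T : System}, (S.Op →ₗ[ℂ] T.Op) → Prop
  | refl (S : System) : IsLOCC (LinearMap.id : S.Op →ₗ[ℂ] S.Op)
  | stepA {S T : System} (I : LocalInstrument S.A)
      (Λ : ∀ j : I.Outcome, (S.withA (I.Out j)).Op →ₗ[ℂ] T.Op) (hΛ : ∀ j, IsLOCC (Λ j)) :
      IsLOCC (∑ j, Λ j ∘ₗ branchA I j)
  | stepB {S T : System} (I : LocalInstrument S.B)
      (Λ : ∀ j : I.Outcome, (S.withB (I.Out j)).Op →ₗ[ℂ] T.Op) (hΛ : ∀ j, IsLOCC (Λ j)) :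
      IsLOCC (∑ j, Λ j ∘ₗ branchB I j)
  | stepC {S T : System} (I : LocalInstrument S.C)
      (Λ : ∀ j : I.Outcome, (S.withC (I.Out j)).Op →ₗ[ℂ] T.Op) (hΛ : ∀ j, IsLOCC (Λ j)) :
      IsLOCC (∑ j, Λ j ∘ₗ branchC I j)

/-- `Λ` preserves the trace. -/
def IsTracePreserving {S T : System} (Λ : S.Op →ₗ[ℂ] T.Op) : Prop :=
  ∀ X : S.Op, (Λ X).trace = X.trace

section Fidelity

open scoped MatrixOrder

/-- The trace norm `‖M‖₁ = Tr √(M† M)`. -/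
def traceNorm {ι : Type} [Fintype ι] [DecidableEq ι] (M : Matrix ι ι ℂ) : ℝ :=
  (CFC.sqrt (M.conjTranspose * M)).trace.re

/-- The fidelity `F(σ, τ) = ‖√σ √τ‖₁²` of positive operators. -/
def fidelity {ι : Type} [Fintype ι] [DecidableEq ι] (σ τ : Matrix ι ι ℂ) : ℝ :=
  traceNorm (CFC.sqrt σ * CFC.sqrt τ) ^ 2

end Fidelity

/-- `ρ → σ`: some trace-nonincreasing LOCC channel maps `ρ` exactly to `σ`. -/
def Transforms {S T : System} (ρ : S.Op) (σ : T.Op) : Prop :=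
  ∃ Λ : S.Op →ₗ[ℂ] T.Op, IsLOCC Λ ∧ Λ ρ = σ

/-- `ρ →_ε σ`: some trace-preserving LOCC channel `Λ` satisfies `F(Λ(ρ), σ) ≥ 1 - ε`. -/
def ApproxTransforms {S T : System} (ε : ℝ) (ρ : S.Op) (σ : T.Op) : Prop :=
  ∃ Λ : S.Op →ₗ[ℂ] T.Op, IsLOCC Λ ∧ IsTracePreserving Λ ∧ 1 - ε ≤ fidelity (Λ ρ) σ

/-- `R(ρ → σ, r)`: optimal rate of exact probabilistic transformations whose failure probability
decays with exponent at least `r`. -/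
def directRate {S T : System} (ρ : S.Op) (σ : T.Op) (r : ℝ) : EReal :=
  sSup {x : EReal | ∃ (n : ℕ → ℕ) (p : ℕ → ℝ),
    (∀ m, 0 < p m ∧ p m < 1) ∧
    (r : EReal) ≤ Filter.liminf
      (fun m : ℕ => ((-(1 / (m : ℝ)) * Real.logb 2 (1 - p m) : ℝ) : EReal)) Filter.atTop ∧
    (∀ m, Transforms (tensorPow ρ m) ((p m : ℂ) • tensorPow σ (n m))) ∧
    x = Filter.limsup (fun m : ℕ => (((n m : ℝ) / (m : ℝ) : ℝ) : EReal)) Filter.atTop}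

/-- `R_F(ρ → σ, r)`: optimal rate of approximate transformations whose infidelity decays with
exponent at least `r`. -/
def directRateFidelity {S T : System} (ρ : S.Op) (σ : T.Op) (r : ℝ) : EReal :=
  sSup {x : EReal | ∃ (n : ℕ → ℕ) (ε : ℕ → ℝ),
    (∀ m, 0 < ε m ∧ ε m < 1) ∧
    (r : EReal) ≤ Filter.liminf
      (fun m : ℕ => ((-(1 / (m : ℝ)) * Real.logb 2 (ε m) : ℝ) : EReal)) Filter.atTop ∧
    (∀ m, ApproxTransforms (ε m) (tensorPow ρ m) (tensorPow σ (n m))) ∧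
    x = Filter.limsup (fun m : ℕ => (((n m : ℝ) / (m : ℝ) : ℝ) : EReal)) Filter.atTop}

/-- Two qubits at `A` and `B`, and a one-dimensional space at `C`. -/
abbrev qubitPair : System := ⟨Fin 2, Fin 2, Fin 1⟩

/-- The vector `(|000⟩ + |110⟩)/√2`. -/
def eprVec : EuclideanSpace ℂ qubitPair.Idx :=
  WithLp.toLp 2 fun x => if x.1 = x.2.1 then ((1 / Real.sqrt 2 : ℝ) : ℂ) else 0

/-- The state `EPR_AB`. -/
def eprAB : qubitPair.Op := ketbra eprVec

end EPRDistill

end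

/-!
Both rates describe the same asymptotic task, because an exact probabilistic protocol and an
approximate one can be turned into each other at the price of a constant factor in the error and
of a single EPR pair.

From exact to approximate: whenever a protocol fails, the parties prepare some fixed product state
instead (`IsLOCC.exists_completion`). The channel becomes trace-preserving, and since the fidelity
with a pure state `e` is `⟨e, σ e⟩` (`fidelity_ketbra`), the infidelity is at most the failure
probability `1 - p` (`ApproxTransforms.of_transforms`).

From approximate to exact: on a pure input, a protocol in which every Kraus label is announced
produces an ensemble of pure states `φ j` on which the parties can continue depending on `j`
(`IsLOCC.exists_pure_branches`). The third party of the target is trivial, so each `φ j` is a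
bipartite state, with squared norm `N` and overlap `F` with `n + 1` EPR pairs. It is enough to
obtain exactly `n` EPR pairs from it with probability at least `N - 24 (N - F)`
(`exists_isLOCC_ketbra_to_epr`): this bound is linear in the ensemble, so the total failure
probability is at most `24 ε`.

For such a state with Schmidt spectrum `lam`, the overlap is at most `(∑ √lam)² / D` with
`D = 2 ^ (n + 1)`. If `F` is close to `N`, the spectrum is close to the uniform one, and cutting it off at
`(3/2) N / D` loses only a weight `6 (N - F)` (`exists_truncation`). No entry of the truncated
spectrum `μ` exceeds the fraction `2 / D` of its total, hence `μ` is a mixture of uniform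
distributions on sets of `D / 2` elements; this follows from Birkhoff's theorem applied to a
suitable doubly stochastic matrix (`exists_perm_weights`). Accordingly `A` performs a measurement
whose outcomes are these sets and which leaves, on each of them, a maximally entangled state of
rank `D / 2` (`exists_distillation_matrices`); `B` only has to restrict to the announced set.

Neither the factor `24` nor the lost pair matters for the exponent
(`le_liminf_exponent_const_mul`) and the rate (`limsup_pred_div`).
-/

noncomputable section

namespace EPRDistill

open Matrix Filter

/-! ### Closure properties of LOCC channels -/

lemma trace_conjBy {ι κ : Type} [Fintype ι] [Fintype κ] (M : Matrix κ ι ℂ) (X : Matrix ι ι ℂ) :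
    (conjBy M X).trace = (Mᴴ * M * X).trace := by
  change (M * X * Mᴴ).trace = _
  rw [Matrix.trace_mul_comm, ← Matrix.mul_assoc]

lemma ketbra_eq_vecMulVec {ι : Type} (φ : EuclideanSpace ℂ ι) :
    ketbra φ = vecMulVec φ.ofLp (star φ.ofLp) := rfl

lemma conjBy_ketbra {ι κ : Type} [Fintype ι] (M : Matrix κ ι ℂ) (ψ : EuclideanSpace ℂ ι) :
    conjBy M (ketbra ψ) = ketbra (WithLp.toLp 2 (M *ᵥ ψ.ofLp)) := by
  rw [ketbra_eq_vecMulVec, ketbra_eq_vecMulVec]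
  change M * vecMulVec ψ.ofLp (star ψ.ofLp) * Matrix.conjTranspose M = _
  rw [Matrix.mul_vecMulVec, Matrix.vecMulVec_mul, Matrix.star_mulVec]

namespace LocalInstrument

/-- The instrument with a single outcome and Kraus operators `K l`. -/
def ofKraus {α X ι : Type} [Fintype α] [DecidableEq α] [Fintype X] [DecidableEq X] [Fintype ι]
    (K : ι → Matrix X α ℂ) (hK : (1 - ∑ l, (K l)ᴴ * K l).PosSemidef) : LocalInstrument α where
  Outcome := Unit
  Label _ := ι
  Out _ := X
  K _ := K
  sum_le_one := by simpa using hK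

/-- The instrument which announces the Kraus label in addition to the outcome, so that every
branch has a single Kraus operator. -/
def refine {α : Type} [Fintype α] [DecidableEq α] (I : LocalInstrument α) : LocalInstrument α where
  Outcome := Σ j, I.Label j
  Label _ := Unit
  Out p := I.Out p.1
  K p _ := I.K p.1 p.2
  sum_le_one := by
    simpa [Fintype.sum_sigma] using I.sum_le_one

open scoped MatrixOrder Matrix.Norms.L2Operator in
lemma exists_complement {α : Type} [Fintype α] [DecidableEq α] (I : LocalInstrument α) :
    ∃ B : Matrix α α ℂ, Bᴴ * B + ∑ j, ∑ l, (I.K j l)ᴴ * I.K j l = 1 := by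
  obtain ⟨B, hB⟩ := CStarAlgebra.nonneg_iff_eq_star_mul_self.mp I.sum_le_one.nonneg
  exact ⟨B, by rw [← Matrix.star_eq_conjTranspose B, ← hB]; abel⟩

/-- The Kraus operator of the missing weight: `B† B = 1 - ∑ K† K`. -/
def complement {α : Type} [Fintype α] [DecidableEq α] (I : LocalInstrument α) : Matrix α α ℂ :=
  I.exists_complement.choose

lemma complement_spec {α : Type} [Fintype α] [DecidableEq α] (I : LocalInstrument α) :
    I.complementᴴ * I.complement + ∑ j, ∑ l, (I.K j l)ᴴ * I.K j l = 1 :=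
  I.exists_complement.choose_spec

/-- The instrument in which failure is announced as the additional outcome `none`. -/
def complete {α : Type} [Fintype α] [DecidableEq α] (I : LocalInstrument α) :
    LocalInstrument α where
  Outcome := Option I.Outcome
  Label
    | none => Unit
    | some j => I.Label j
  fintypeLabel
    | none => inferInstanceAs (Fintype Unit)
    | some j => I.fintypeLabel j
  Out
    | none => α
    | some j => I.Out j
  fintypeOut
    | none => inferInstanceAs (Fintype α)
    | some j => I.fintypeOut j
  decEqOut
    | none => inferInstanceAs (DecidableEq α)
    | some j => I.decEqOut j
  K
    | none => fun _ => I.complement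
    | some j => I.K j
  sum_le_one := by
    rw [Fintype.sum_option]
    have h : ∑ _l : Unit, I.complementᴴ * I.complement + ∑ j, ∑ l, (I.K j l)ᴴ * I.K j l = 1 := by
      simpa using I.complement_spec
    have h0 : (0 : Matrix α α ℂ).PosSemidef := Matrix.PosSemidef.zero
    rw [← sub_self (1 : Matrix α α ℂ)] at h0
    exact (congrArg (fun Z : Matrix α α ℂ => (1 - Z).PosSemidef) h).mpr h0

section Sums

variable {α M : Type} [Fintype α] [DecidableEq α] [AddCommMonoid M]

lemma sum_ofKraus {X ι : Type} [Fintype X] [DecidableEq X] [Fintype ι] {K : ι → Matrix X α ℂ}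
    {hK : (1 - ∑ l, (K l)ᴴ * K l).PosSemidef} (f : (ofKraus K hK).Outcome → M) :
    ∑ j, f j = f () :=
  Fintype.sum_unique (ι := Unit) f

lemma sum_complete (I : LocalInstrument α) (f : I.complete.Outcome → M) :
    ∑ j, f j = f none + ∑ j, f (some j) :=
  Fintype.sum_option f

end Sums

lemma sum_complete_eq_one {α : Type} [Fintype α] [DecidableEq α] (I : LocalInstrument α) :
    ∑ j, ∑ l, (I.complete.K j l)ᴴ * I.complete.K j l = 1 := by
  rw [sum_complete, ← I.complement_spec]
  congr 1
  exact Fintype.sum_unique (ι := Unit) _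

end LocalInstrument

lemma sum_kronecker {ι k l m n : Type} [Fintype ι] (f : ι → Matrix k l ℂ) (N : Matrix m n ℂ) :
    (∑ i, f i) ⊗ₖ N = ∑ i, f i ⊗ₖ N := by
  ext a b
  simp [Matrix.sum_apply, Finset.sum_mul]

lemma kronecker_sum {ι k l m n : Type} [Fintype ι] (N : Matrix k l ℂ) (f : ι → Matrix m n ℂ) :
    N ⊗ₖ (∑ i, f i) = ∑ i, N ⊗ₖ f i := by
  ext a b
  simp [Matrix.sum_apply, Finset.mul_sum]

lemma linearMap_comp_sum {ι M N P : Type} [Fintype ι] [AddCommGroup M] [Module ℂ M]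
    [AddCommGroup N] [Module ℂ N] [AddCommGroup P] [Module ℂ P] (g : N →ₗ[ℂ] P)
    (f : ι → M →ₗ[ℂ] N) : g ∘ₗ (∑ i, f i) = ∑ i, g ∘ₗ f i := by
  ext1 x
  simp

lemma sum_trace_branchA {S : System} (I : LocalInstrument S.A) (X : S.Op) :
    ∑ j, (branchA I j X).trace = (((∑ j, ∑ l, (I.K j l)ᴴ * I.K j l) ⊗ₖ
      ((1 : Matrix S.B S.B ℂ) ⊗ₖ (1 : Matrix S.C S.C ℂ))) * X).trace := by
  simp only [sum_kronecker, Matrix.sum_mul, Matrix.trace_sum, branchA,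
    LinearMap.sum_apply, trace_conjBy]
  simp only [Matrix.conjTranspose_kronecker, ← Matrix.mul_kronecker_mul, conjTranspose_one, mul_one]

lemma sum_trace_branchB {S : System} (I : LocalInstrument S.B) (X : S.Op) :
    ∑ j, (branchB I j X).trace = (((1 : Matrix S.A S.A ℂ) ⊗ₖ
      ((∑ j, ∑ l, (I.K j l)ᴴ * I.K j l) ⊗ₖ (1 : Matrix S.C S.C ℂ))) * X).trace := by
  simp only [sum_kronecker, kronecker_sum, Matrix.sum_mul, Matrix.trace_sum, branchB,
    LinearMap.sum_apply, trace_conjBy]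
  simp only [Matrix.conjTranspose_kronecker, ← Matrix.mul_kronecker_mul, conjTranspose_one, mul_one]

lemma sum_trace_branchC {S : System} (I : LocalInstrument S.C) (X : S.Op) :
    ∑ j, (branchC I j X).trace = (((1 : Matrix S.A S.A ℂ) ⊗ₖ
      ((1 : Matrix S.B S.B ℂ) ⊗ₖ (∑ j, ∑ l, (I.K j l)ᴴ * I.K j l))) * X).trace := by
  simp only [kronecker_sum, Matrix.sum_mul, Matrix.trace_sum, branchC,
    LinearMap.sum_apply, trace_conjBy]
  simp only [Matrix.conjTranspose_kronecker, ← Matrix.mul_kronecker_mul, conjTranspose_one, mul_one]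

lemma IsLOCC.comp {S T U : System} {Λ : S.Op →ₗ[ℂ] T.Op} (hΛ : IsLOCC Λ)
    {Γ : T.Op →ₗ[ℂ] U.Op} (hΓ : IsLOCC Γ) : IsLOCC (Γ ∘ₗ Λ) := by
  induction hΛ with
  | refl S => exact hΓ
  | stepA I Λ _ ih =>
    rw [linearMap_comp_sum]
    simp only [← LinearMap.comp_assoc]
    exact IsLOCC.stepA I _ fun j => ih j hΓ
  | stepB I Λ _ ih =>
    rw [linearMap_comp_sum]
    simp only [← LinearMap.comp_assoc]
    exact IsLOCC.stepB I _ fun j => ih j hΓ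
  | stepC I Λ _ ih =>
    rw [linearMap_comp_sum]
    simp only [← LinearMap.comp_assoc]
    exact IsLOCC.stepC I _ fun j => ih j hΓ

section LocalChannels

variable {S : System} {X ι : Type} [Fintype X] [DecidableEq X] [Fintype ι]

/-- The local channel of party `A` with Kraus operators `K l`. -/
def localA (K : ι → Matrix X S.A ℂ) : S.Op →ₗ[ℂ] (S.withA X).Op :=
  ∑ l, conjBy (K l ⊗ₖ ((1 : Matrix S.B S.B ℂ) ⊗ₖ (1 : Matrix S.C S.C ℂ)))

lemma isLOCC_localA (K : ι → Matrix X S.A ℂ) (hK : (1 - ∑ l, (K l)ᴴ * K l).PosSemidef) :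
    IsLOCC (localA (S := S) K) := by
  have h := IsLOCC.stepA (S := S) (T := S.withA X) (LocalInstrument.ofKraus K hK)
    (fun _ => LinearMap.id) (fun _ => IsLOCC.refl _)
  rw [LocalInstrument.sum_ofKraus] at h
  exact h

lemma trace_localA (K : ι → Matrix X S.A ℂ) (hK : ∑ l, (K l)ᴴ * K l = 1) (Z : S.Op) :
    (localA (S := S) K Z).trace = Z.trace := by
  have h := sum_trace_branchA (LocalInstrument.ofKraus K (by
    rw [hK, sub_self]; exact Matrix.PosSemidef.zero)) Z
  rw [LocalInstrument.sum_ofKraus, LocalInstrument.sum_ofKraus] at h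
  refine Eq.trans (h.trans
    (?_ : (((∑ l, (K l)ᴴ * K l) ⊗ₖ ((1 : Matrix S.B S.B ℂ) ⊗ₖ (1 : Matrix S.C S.C ℂ))) *
      Z).trace = _)) rfl
  rw [hK, Matrix.one_kronecker_one, Matrix.one_kronecker_one, Matrix.one_mul]

/-- The local channel of party `B` with Kraus operators `K l`. -/
def localB (K : ι → Matrix X S.B ℂ) : S.Op →ₗ[ℂ] (S.withB X).Op :=
  ∑ l, conjBy ((1 : Matrix S.A S.A ℂ) ⊗ₖ (K l ⊗ₖ (1 : Matrix S.C S.C ℂ)))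

lemma isLOCC_localB (K : ι → Matrix X S.B ℂ) (hK : (1 - ∑ l, (K l)ᴴ * K l).PosSemidef) :
    IsLOCC (localB (S := S) K) := by
  have h := IsLOCC.stepB (S := S) (T := S.withB X) (LocalInstrument.ofKraus K hK)
    (fun _ => LinearMap.id) (fun _ => IsLOCC.refl _)
  rw [LocalInstrument.sum_ofKraus] at h
  exact h

lemma trace_localB (K : ι → Matrix X S.B ℂ) (hK : ∑ l, (K l)ᴴ * K l = 1) (Z : S.Op) :
    (localB (S := S) K Z).trace = Z.trace := by
  have h := sum_trace_branchB (LocalInstrument.ofKraus K (by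
    rw [hK, sub_self]; exact Matrix.PosSemidef.zero)) Z
  rw [LocalInstrument.sum_ofKraus, LocalInstrument.sum_ofKraus] at h
  refine Eq.trans (h.trans
    (?_ : (((1 : Matrix S.A S.A ℂ) ⊗ₖ ((∑ l, (K l)ᴴ * K l) ⊗ₖ (1 : Matrix S.C S.C ℂ))) *
      Z).trace = _)) rfl
  rw [hK, Matrix.one_kronecker_one, Matrix.one_kronecker_one, Matrix.one_mul]

/-- The local channel of party `C` with Kraus operators `K l`. -/
def localC (K : ι → Matrix X S.C ℂ) : S.Op →ₗ[ℂ] (S.withC X).Op :=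
  ∑ l, conjBy ((1 : Matrix S.A S.A ℂ) ⊗ₖ ((1 : Matrix S.B S.B ℂ) ⊗ₖ K l))

lemma isLOCC_localC (K : ι → Matrix X S.C ℂ) (hK : (1 - ∑ l, (K l)ᴴ * K l).PosSemidef) :
    IsLOCC (localC (S := S) K) := by
  have h := IsLOCC.stepC (S := S) (T := S.withC X) (LocalInstrument.ofKraus K hK)
    (fun _ => LinearMap.id) (fun _ => IsLOCC.refl _)
  rw [LocalInstrument.sum_ofKraus] at h
  exact h

lemma trace_localC (K : ι → Matrix X S.C ℂ) (hK : ∑ l, (K l)ᴴ * K l = 1) (Z : S.Op) :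
    (localC (S := S) K Z).trace = Z.trace := by
  have h := sum_trace_branchC (LocalInstrument.ofKraus K (by
    rw [hK, sub_self]; exact Matrix.PosSemidef.zero)) Z
  rw [LocalInstrument.sum_ofKraus, LocalInstrument.sum_ofKraus] at h
  refine Eq.trans (h.trans
    (?_ : (((1 : Matrix S.A S.A ℂ) ⊗ₖ ((1 : Matrix S.B S.B ℂ) ⊗ₖ (∑ l, (K l)ᴴ * K l))) *
      Z).trace = _)) rfl
  rw [hK, Matrix.one_kronecker_one, Matrix.one_kronecker_one, Matrix.one_mul]

end LocalChannels

/-- The instrument without outcomes always fails. -/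
lemma isLOCC_zero (S T : System) : IsLOCC (0 : S.Op →ₗ[ℂ] T.Op) := by
  let I : LocalInstrument S.A :=
    { Outcome := Empty
      Label := fun j => j.elim
      fintypeLabel := fun j => j.elim
      Out := fun j => j.elim
      fintypeOut := fun j => j.elim
      decEqOut := fun j => j.elim
      K := fun j => j.elim
      sum_le_one := by simpa using Matrix.PosSemidef.one }
  have h := IsLOCC.stepA (S := S) (T := T) I (fun j => j.elim) (fun j => j.elim)
  convert h using 1
  exact (Fintype.sum_empty (ι := Empty) _).symm

/-- The parties may abort with a fixed probability. -/
lemma IsLOCC.smul {S T : System} {Λ : S.Op →ₗ[ℂ] T.Op} (hΛ : IsLOCC Λ) {c : ℝ} (h0 : 0 ≤ c)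
    (h1 : c ≤ 1) : IsLOCC ((c : ℂ) • Λ) := by
  have hs : star ((Real.sqrt c : ℝ) : ℂ) * ((Real.sqrt c : ℝ) : ℂ) = c := by
    rw [Complex.star_def, Complex.conj_ofReal, ← Complex.ofReal_mul, Real.mul_self_sqrt h0]
  have hK : (1 - ∑ _l : Unit, (((Real.sqrt c : ℝ) : ℂ) • (1 : Matrix S.A S.A ℂ))ᴴ *
      (((Real.sqrt c : ℝ) : ℂ) • (1 : Matrix S.A S.A ℂ))).PosSemidef := by
    have h : (1 - ∑ _l : Unit, (((Real.sqrt c : ℝ) : ℂ) • (1 : Matrix S.A S.A ℂ))ᴴ *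
      (((Real.sqrt c : ℝ) : ℂ) • (1 : Matrix S.A S.A ℂ))) =
        ((1 - c : ℝ) : ℂ) • (1 : Matrix S.A S.A ℂ) := by
      rw [Fintype.sum_unique, conjTranspose_smul, conjTranspose_one, smul_mul_smul, mul_one, hs]
      push_cast
      rw [sub_smul, one_smul]
    rw [h]
    exact Matrix.PosSemidef.one.smul (by exact_mod_cast sub_nonneg.2 h1)
  convert (isLOCC_localA (S := S) _ hK).comp hΛ using 1
  ext1 X
  have hb : localA (S := S) (fun _ : Unit => ((Real.sqrt c : ℝ) : ℂ) • (1 : Matrix S.A S.A ℂ)) =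
      conjBy ((((Real.sqrt c : ℝ) : ℂ) • (1 : Matrix S.A S.A ℂ)) ⊗ₖ
        ((1 : Matrix S.B S.B ℂ) ⊗ₖ (1 : Matrix S.C S.C ℂ))) :=
    Fintype.sum_unique (ι := Unit) _
  rw [hb, Matrix.smul_kronecker, Matrix.one_kronecker_one, Matrix.one_kronecker_one,
    LinearMap.comp_apply]
  have : conjBy (((Real.sqrt c : ℝ) : ℂ) • (1 : Matrix S.Idx S.Idx ℂ)) X = (c : ℂ) • X := by
    change (((Real.sqrt c : ℝ) : ℂ) • (1 : Matrix S.Idx S.Idx ℂ)) * X * (_)ᴴ = _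
    rw [conjTranspose_smul, conjTranspose_one]
    simp only [Matrix.smul_mul, Matrix.mul_smul, Matrix.one_mul, Matrix.mul_one, smul_smul]
    rw [hs]
  rw [this, map_smul]
  rfl

/-- Any system can be discarded and replaced by a fixed product state. -/
lemma exists_isLOCC_isTracePreserving (S T : System) (t : T.Idx) :
    ∃ Λ : S.Op →ₗ[ℂ] T.Op, IsLOCC Λ ∧ IsTracePreserving Λ := by
  have hK : ∀ {α X : Type} [Fintype α] [DecidableEq α] [Fintype X] [DecidableEq X] (x : X),
      ∑ l : α, (Matrix.single x l (1 : ℂ))ᴴ * Matrix.single x l (1 : ℂ) = 1 := by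
    intro α X _ _ _ _ x
    simp only [conjTranspose_single, star_one, single_mul_single_same, mul_one]
    ext i j
    simp [Matrix.sum_apply, Matrix.single_apply, Matrix.one_apply, ite_and]
  have hK' : ∀ {α X : Type} [Fintype α] [DecidableEq α] [Fintype X] [DecidableEq X] (x : X),
      (1 - ∑ l : α, (Matrix.single x l (1 : ℂ))ᴴ * Matrix.single x l (1 : ℂ)).PosSemidef := by
    intro α X _ _ _ _ x
    rw [hK, sub_self]
    exact Matrix.PosSemidef.zero
  refine ⟨_, ((isLOCC_localA (S := S) _ (hK' t.1)).comp
    (isLOCC_localB (S := S.withA T.A) _ (hK' t.2.1))).comp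
    (isLOCC_localC (S := (S.withA T.A).withB T.B) _ (hK' t.2.2)), fun Z => ?_⟩
  rw [LinearMap.comp_apply, LinearMap.comp_apply]
  exact (trace_localC _ (hK _) _).trans ((trace_localB _ (hK _) _).trans (trace_localA _ (hK _) _))

/-! ### Completing a channel to a trace-preserving one -/

/-- If failure is always replaced by the preparation of some product state, the channel becomes
trace-preserving, and what is added to it is again an LOCC channel. -/
lemma IsLOCC.exists_completion {S T : System} {Λ : S.Op →ₗ[ℂ] T.Op} (hΛ : IsLOCC Λ) (t : T.Idx) :
    ∃ Γ : S.Op →ₗ[ℂ] T.Op, IsLOCC Γ ∧ IsLOCC (Λ + Γ) ∧ IsTracePreserving (Λ + Γ) := by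
  induction hΛ with
  | refl S => exact ⟨0, isLOCC_zero _ _, by simpa using IsLOCC.refl S, fun X => by simp⟩
  | @stepA S T I Λ _ ih =>
    choose Γ h1 h2 h3 using fun j => ih j t
    obtain ⟨P, hP, hPt⟩ := exists_isLOCC_isTracePreserving S T t
    let Γ' : ∀ j : I.complete.Outcome, (S.withA (I.complete.Out j)).Op →ₗ[ℂ] T.Op
      | none => P
      | some j => Γ j
    let Λ' : ∀ j : I.complete.Outcome, (S.withA (I.complete.Out j)).Op →ₗ[ℂ] T.Op
      | none => P
      | some j => Λ j + Γ j
    have hadd : ∑ j, Λ j ∘ₗ branchA I j + ∑ j, Γ' j ∘ₗ branchA I.complete j =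
        ∑ j, Λ' j ∘ₗ branchA I.complete j := by
      rw [I.sum_complete, I.sum_complete, add_left_comm, ← Finset.sum_add_distrib]
      rfl
    refine ⟨_, IsLOCC.stepA I.complete Γ' ?_, ?_, ?_⟩
    · rintro (_ | j)
      exacts [hP, h1 j]
    · rw [hadd]
      refine IsLOCC.stepA I.complete Λ' ?_
      rintro (_ | j)
      exacts [hP, h2 j]
    · intro X
      have hΛ' : ∀ j, IsTracePreserving (Λ' j) := by
        rintro (_ | j)
        exacts [hPt, h3 j]
      rw [hadd, LinearMap.sum_apply, Matrix.trace_sum]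
      simp only [LinearMap.comp_apply, hΛ' _ _]
      rw [sum_trace_branchA, I.sum_complete_eq_one, Matrix.one_kronecker_one,
        Matrix.one_kronecker_one, Matrix.one_mul]
  | @stepB S T I Λ _ ih =>
    choose Γ h1 h2 h3 using fun j => ih j t
    obtain ⟨P, hP, hPt⟩ := exists_isLOCC_isTracePreserving S T t
    let Γ' : ∀ j : I.complete.Outcome, (S.withB (I.complete.Out j)).Op →ₗ[ℂ] T.Op
      | none => P
      | some j => Γ j
    let Λ' : ∀ j : I.complete.Outcome, (S.withB (I.complete.Out j)).Op →ₗ[ℂ] T.Op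
      | none => P
      | some j => Λ j + Γ j
    have hadd : ∑ j, Λ j ∘ₗ branchB I j + ∑ j, Γ' j ∘ₗ branchB I.complete j =
        ∑ j, Λ' j ∘ₗ branchB I.complete j := by
      rw [I.sum_complete, I.sum_complete, add_left_comm, ← Finset.sum_add_distrib]
      rfl
    refine ⟨_, IsLOCC.stepB I.complete Γ' ?_, ?_, ?_⟩
    · rintro (_ | j)
      exacts [hP, h1 j]
    · rw [hadd]
      refine IsLOCC.stepB I.complete Λ' ?_
      rintro (_ | j)
      exacts [hP, h2 j]
    · intro X
      have hΛ' : ∀ j, IsTracePreserving (Λ' j) := by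
        rintro (_ | j)
        exacts [hPt, h3 j]
      rw [hadd, LinearMap.sum_apply, Matrix.trace_sum]
      simp only [LinearMap.comp_apply, hΛ' _ _]
      rw [sum_trace_branchB, I.sum_complete_eq_one, Matrix.one_kronecker_one,
        Matrix.one_kronecker_one, Matrix.one_mul]
  | @stepC S T I Λ _ ih =>
    choose Γ h1 h2 h3 using fun j => ih j t
    obtain ⟨P, hP, hPt⟩ := exists_isLOCC_isTracePreserving S T t
    let Γ' : ∀ j : I.complete.Outcome, (S.withC (I.complete.Out j)).Op →ₗ[ℂ] T.Op
      | none => P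
      | some j => Γ j
    let Λ' : ∀ j : I.complete.Outcome, (S.withC (I.complete.Out j)).Op →ₗ[ℂ] T.Op
      | none => P
      | some j => Λ j + Γ j
    have hadd : ∑ j, Λ j ∘ₗ branchC I j + ∑ j, Γ' j ∘ₗ branchC I.complete j =
        ∑ j, Λ' j ∘ₗ branchC I.complete j := by
      rw [I.sum_complete, I.sum_complete, add_left_comm, ← Finset.sum_add_distrib]
      rfl
    refine ⟨_, IsLOCC.stepC I.complete Γ' ?_, ?_, ?_⟩
    · rintro (_ | j)
      exacts [hP, h1 j]
    · rw [hadd]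
      refine IsLOCC.stepC I.complete Λ' ?_
      rintro (_ | j)
      exacts [hP, h2 j]
    · intro X
      have hΛ' : ∀ j, IsTracePreserving (Λ' j) := by
        rintro (_ | j)
        exacts [hPt, h3 j]
      rw [hadd, LinearMap.sum_apply, Matrix.trace_sum]
      simp only [LinearMap.comp_apply, hΛ' _ _]
      rw [sum_trace_branchC, I.sum_complete_eq_one, Matrix.one_kronecker_one,
        Matrix.one_kronecker_one, Matrix.one_mul]

/-! ### Pure branches of a channel -/

/-- On a pure input an LOCC channel produces an ensemble of pure states `φ j`, and the parties may
keep the label `j` in order to continue with a protocol `Γ j` which depends on it. -/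
lemma IsLOCC.exists_pure_branches {S T : System} {Λ : S.Op →ₗ[ℂ] T.Op} (hΛ : IsLOCC Λ)
    (ψ : EuclideanSpace ℂ S.Idx) :
    ∃ (J : Type) (_ : Fintype J) (φ : J → EuclideanSpace ℂ T.Idx),
      Λ (ketbra ψ) = ∑ j, ketbra (φ j) ∧
      ∀ (U : System) (Γ : J → T.Op →ₗ[ℂ] U.Op), (∀ j, IsLOCC (Γ j)) →
        ∃ Λ' : S.Op →ₗ[ℂ] U.Op, IsLOCC Λ' ∧ Λ' (ketbra ψ) = ∑ j, Γ j (ketbra (φ j)) := by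
  induction hΛ with
  | refl S =>
    exact ⟨Unit, inferInstance, fun _ => ψ, by simp, fun U Γ hΓ => ⟨Γ (), hΓ (), by simp⟩⟩
  | @stepA S T I Λ _ ih =>
    choose J hJ φ h1 h2 using fun p : Σ j, I.Label j => ih p.1 (WithLp.toLp 2
      ((I.K p.1 p.2 ⊗ₖ ((1 : Matrix S.B S.B ℂ) ⊗ₖ (1 : Matrix S.C S.C ℂ))) *ᵥ ψ.ofLp))
    refine ⟨Σ p, J p, inferInstance, fun q => φ q.1 q.2, ?_, fun U Γ hΓ => ?_⟩
    · simp only [LinearMap.sum_apply, LinearMap.comp_apply, branchA, map_sum, conjBy_ketbra]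
      rw [Fintype.sum_sigma, Fintype.sum_sigma]
      exact Finset.sum_congr rfl fun j _ => Finset.sum_congr rfl fun l _ => h1 ⟨j, l⟩
    · choose Λ' h3 h4 using fun p => h2 p U (fun j => Γ ⟨p, j⟩) (fun j => hΓ _)
      refine ⟨_, IsLOCC.stepA I.refine Λ' h3, ?_⟩
      rw [Fintype.sum_sigma, LinearMap.sum_apply]
      refine Finset.sum_congr rfl fun p _ => (Eq.trans ?_ (h4 p))
      rw [← conjBy_ketbra]
      refine congrArg (Λ' p) (LinearMap.congr_fun (?_ : _ = conjBy _) (ketbra ψ))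
      exact Fintype.sum_unique (ι := Unit) _
  | @stepB S T I Λ _ ih =>
    choose J hJ φ h1 h2 using fun p : Σ j, I.Label j => ih p.1 (WithLp.toLp 2
      (((1 : Matrix S.A S.A ℂ) ⊗ₖ (I.K p.1 p.2 ⊗ₖ (1 : Matrix S.C S.C ℂ))) *ᵥ ψ.ofLp))
    refine ⟨Σ p, J p, inferInstance, fun q => φ q.1 q.2, ?_, fun U Γ hΓ => ?_⟩
    · simp only [LinearMap.sum_apply, LinearMap.comp_apply, branchB, map_sum, conjBy_ketbra]
      rw [Fintype.sum_sigma, Fintype.sum_sigma]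
      exact Finset.sum_congr rfl fun j _ => Finset.sum_congr rfl fun l _ => h1 ⟨j, l⟩
    · choose Λ' h3 h4 using fun p => h2 p U (fun j => Γ ⟨p, j⟩) (fun j => hΓ _)
      refine ⟨_, IsLOCC.stepB I.refine Λ' h3, ?_⟩
      rw [Fintype.sum_sigma, LinearMap.sum_apply]
      refine Finset.sum_congr rfl fun p _ => (Eq.trans ?_ (h4 p))
      rw [← conjBy_ketbra]
      refine congrArg (Λ' p) (LinearMap.congr_fun (?_ : _ = conjBy _) (ketbra ψ))
      exact Fintype.sum_unique (ι := Unit) _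
  | @stepC S T I Λ _ ih =>
    choose J hJ φ h1 h2 using fun p : Σ j, I.Label j => ih p.1 (WithLp.toLp 2
      (((1 : Matrix S.A S.A ℂ) ⊗ₖ ((1 : Matrix S.B S.B ℂ) ⊗ₖ I.K p.1 p.2)) *ᵥ ψ.ofLp))
    refine ⟨Σ p, J p, inferInstance, fun q => φ q.1 q.2, ?_, fun U Γ hΓ => ?_⟩
    · simp only [LinearMap.sum_apply, LinearMap.comp_apply, branchC, map_sum, conjBy_ketbra]
      rw [Fintype.sum_sigma, Fintype.sum_sigma]
      exact Finset.sum_congr rfl fun j _ => Finset.sum_congr rfl fun l _ => h1 ⟨j, l⟩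
    · choose Λ' h3 h4 using fun p => h2 p U (fun j => Γ ⟨p, j⟩) (fun j => hΓ _)
      refine ⟨_, IsLOCC.stepC I.refine Λ' h3, ?_⟩
      rw [Fintype.sum_sigma, LinearMap.sum_apply]
      refine Finset.sum_congr rfl fun p _ => (Eq.trans ?_ (h4 p))
      rw [← conjBy_ketbra]
      refine congrArg (Λ' p) (LinearMap.congr_fun (?_ : _ = conjBy _) (ketbra ψ))
      exact Fintype.sum_unique (ι := Unit) _

/-! ### Truncating a Schmidt spectrum -/

/-- Let `N = ∑ lam` and let `G ≤ (∑ √lam)² / D`, where `D` is the size of the spectrum `lam`. If `G`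
is close to `N`, then cutting off `lam` at the height `(3/2) N / D` costs at most `6 (N - G)` of
the weight, so that the largest remaining weight is at most `2 / D` of what remains. The hypothesis
`hsmall` is what the second fact needs; the loss is stated with the same constant. -/
lemma exists_truncation {α : Type} [Fintype α] [Nonempty α] (lam : α → ℝ) (h0 : ∀ i, 0 ≤ lam i)
    {G : ℝ} (hG0 : 0 ≤ G) (hG : Fintype.card α * G ≤ (∑ i, √(lam i)) ^ 2)
    (hsmall : 24 * (∑ i, lam i - G) < ∑ i, lam i) :
    ∃ μ : α → ℝ, (∀ i, 0 ≤ μ i) ∧ (∀ i, μ i ≤ lam i) ∧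
      ∑ i, lam i - 24 * (∑ i, lam i - G) ≤ ∑ i, μ i ∧ 0 < ∑ i, μ i ∧
      ∀ i, Fintype.card α * μ i ≤ 2 * ∑ i, μ i := by
  set N := ∑ i, lam i with hN
  set D : ℝ := (Fintype.card α : ℝ) with hD
  have hDpos : 0 < D := by rw [hD]; exact_mod_cast Fintype.card_pos
  have hN0 : 0 ≤ N := Finset.sum_nonneg fun i _ => h0 i
  -- `u` is the Schmidt coefficient of the maximally entangled state with squared norm `N`.
  set u := √(N / D) with hu
  have hu2 : u ^ 2 = N / D := Real.sq_sqrt (div_nonneg hN0 hDpos.le)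
  have hDu : D * u ^ 2 = N := by rw [hu2]; field_simp
  set Q := ∑ i, (√(lam i) - u) ^ 2 with hQ
  set s := ∑ i, √(lam i) with hs
  have hs0 : 0 ≤ s := Finset.sum_nonneg fun i _ => Real.sqrt_nonneg _
  have hQ0 : 0 ≤ Q := Finset.sum_nonneg fun i _ => sq_nonneg _
  have hu0 : 0 ≤ u := Real.sqrt_nonneg _
  have hQs : Q = 2 * N - 2 * u * s := by
    have : ∀ i, (√(lam i) - u) ^ 2 = lam i - 2 * u * √(lam i) + u ^ 2 := fun i => by
      nlinarith [Real.sq_sqrt (h0 i)]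
    rw [hQ, Finset.sum_congr rfl fun i _ => this i, Finset.sum_add_distrib,
      Finset.sum_sub_distrib, ← Finset.mul_sum, Finset.sum_const, Finset.card_univ, nsmul_eq_mul,
      ← hD, hDu]
    ring
  -- `N G ≤ (u s)²` with `u s = N - Q / 2 ≤ N`, hence `G ≤ u s`.
  have hNG : N * G ≤ (u * s) ^ 2 := by
    rw [mul_pow, hu2, div_mul_eq_mul_div, le_div_iff₀ hDpos]
    nlinarith
  have hQG : Q ≤ 2 * (N - G) := by
    rcases hN0.eq_or_lt with h | h
    · have hlam0 : ∀ i, lam i = 0 := fun i =>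
        (Finset.sum_eq_zero_iff_of_nonneg fun i _ => h0 i).1 h.symm i (Finset.mem_univ i)
      have hs0' : s = 0 := Finset.sum_eq_zero fun i _ => by rw [hlam0 i, Real.sqrt_zero]
      have hG' : G = 0 := by rw [hs0'] at hG; nlinarith
      rw [hQs, hs0', hG']
      linarith
    · have h1 : u * s ≤ N := by linarith
      have h2 : (u * s) ^ 2 ≤ N * (u * s) := by nlinarith [mul_nonneg hu0 hs0]
      have h3 : G ≤ u * s := le_of_mul_le_mul_left (hNG.trans h2) h
      linarith
  have hpt : ∀ i, lam i - min (lam i) (3 / 2 * u ^ 2) ≤ 3 * (√(lam i) - u) ^ 2 := fun i => by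
    have h := Real.sq_sqrt (h0 i)
    rcases min_choice (lam i) (3 / 2 * u ^ 2) with h' | h' <;> rw [h']
    · nlinarith [sq_nonneg (√(lam i) - u)]
    · nlinarith [sq_nonneg (2 * √(lam i) - 3 * u)]
  have hloss : N - ∑ i, min (lam i) (3 / 2 * u ^ 2) ≤ 3 * Q := by
    rw [hN, hQ, ← Finset.sum_sub_distrib, Finset.mul_sum]
    exact Finset.sum_le_sum fun i _ => hpt i
  -- As `24 (N - G) < N`, what remains is at least `3/4 N`, which is `D / 2` times the height.
  refine ⟨fun i => min (lam i) (3 / 2 * u ^ 2), fun i => le_min (h0 i) (by positivity),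
    fun i => min_le_left _ _, by linarith, by linarith, fun i => ?_⟩
  have h1 : D * min (lam i) (3 / 2 * u ^ 2) ≤ D * (3 / 2 * u ^ 2) :=
    mul_le_mul_of_nonneg_left (min_le_right _ _) hDpos.le
  linarith

/-! ### Mixtures of uniform distributions -/

/-- A vector with entries in `[0, 1]` and sum `|β|` is a convex combination of indicator functions
of `|β|`-element sets, here the images of `β` under the permutations `π`. -/
lemma exists_perm_weights {α β : Type} [Fintype α] [DecidableEq α] [Fintype β] (e : β ↪ α)
    (hcard : Fintype.card β < Fintype.card α) (hβ : 0 < Fintype.card β) (v : α → ℝ)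
    (h0 : ∀ i, 0 ≤ v i) (h1 : ∀ i, v i ≤ 1) (hv : ∑ i, v i = Fintype.card β) :
    ∃ w : Equiv.Perm α → ℝ, (∀ π, 0 ≤ w π) ∧ ∑ π, w π = 1 ∧
      ∀ j, ∑ π, ∑ x, (if π (e x) = j then w π else 0) = v j := by
  classical
  set K : ℝ := (Fintype.card β : ℝ) with hK
  set D : ℝ := (Fintype.card α : ℝ) with hD
  have hKpos : 0 < K := by rw [hK]; exact_mod_cast hβ
  have hDK : 0 < D - K := by rw [hK, hD, sub_pos]; exact_mod_cast hcard
  -- The rows of `R` in the range of `e` carry `v / |β|`, and the other ones the complementary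
  -- distribution. By Birkhoff's theorem `R` is a mixture of permutations.
  let R : Matrix α α ℝ := Matrix.of fun i j =>
    if i ∈ Set.range e then v j / K else (1 - v j) / (D - K)
  have hsumβ : ∀ f : α → ℝ, ∑ i, (if i ∈ Set.range e then f i else 0) = ∑ x, f (e x) := by
    intro f
    rw [← Finset.sum_filter]
    rw [show Finset.univ.filter (fun i => i ∈ Set.range e) = Finset.univ.map e by ext; simp,
      Finset.sum_map]
  have hcol : ∀ f g : ℝ, ∑ i : α, (if i ∈ Set.range e then f else g) = K * f + (D - K) * g := by
    intro f g
    have h : ∀ i : α, (if i ∈ Set.range e then f else g) =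
        (if i ∈ Set.range e then f - g else 0) + g := fun i => by split_ifs <;> ring
    rw [Finset.sum_congr rfl fun i _ => h i, Finset.sum_add_distrib, hsumβ fun _ => f - g]
    simp only [Finset.sum_const, Finset.card_univ, nsmul_eq_mul, ← hK, ← hD]
    ring
  have hR : R ∈ doublyStochastic ℝ α := by
    rw [mem_doublyStochastic_iff_sum]
    refine ⟨fun i j => ?_, fun i => ?_, fun j => ?_⟩
    · simp only [R, Matrix.of_apply]
      split_ifs
      · exact div_nonneg (h0 j) hKpos.le
      · exact div_nonneg (sub_nonneg.2 (h1 j)) hDK.le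
    · simp only [R, Matrix.of_apply]
      split_ifs
      · rw [← Finset.sum_div, hv, div_self hKpos.ne']
      · rw [← Finset.sum_div, Finset.sum_sub_distrib, hv]
        simp only [Finset.sum_const, Finset.card_univ, nsmul_eq_mul, mul_one, ← hD]
        exact div_self hDK.ne'
    · simp only [R, Matrix.of_apply]
      rw [hcol, mul_div_cancel₀ _ hKpos.ne', mul_div_cancel₀ _ hDK.ne']
      ring
  obtain ⟨w, hw0, hw1, hw⟩ := exists_eq_sum_perm_of_mem_doublyStochastic hR
  refine ⟨w, hw0, hw1, fun j => ?_⟩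
  rw [Finset.sum_comm]
  have hx : ∀ x : β, ∑ π, (if π (e x) = j then w π else 0) = v j / K := fun x => by
    have h := congrFun (congrFun hw (e x)) j
    simpa [R, Matrix.sum_apply, Equiv.Perm.permMatrix, PEquiv.toMatrix_apply, eq_comm] using h
  rw [Finset.sum_congr rfl fun x _ => hx x]
  simp only [Finset.sum_const, Finset.card_univ, nsmul_eq_mul, ← hK]
  field_simp

/-! ### Distilling a single pure branch -/

/-- The adjoint of a contraction is a contraction: both statements say that the block matrix with
unit diagonal blocks and off-diagonal block `H` is positive. -/
lemma posSemidef_one_sub_conjTranspose_mul {m n : Type} [Fintype m] [Fintype n] [DecidableEq m]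
    [DecidableEq n] (H : Matrix m n ℂ) (h : (1 - H * Hᴴ).PosSemidef) :
    (1 - Hᴴ * H).PosSemidef := by
  let _ : Invertible (1 : Matrix m m ℂ) := invertibleOne
  let _ : Invertible (1 : Matrix n n ℂ) := invertibleOne
  have h1 := Matrix.PosDef.fromBlocks₁₁ H (1 : Matrix n n ℂ) (Matrix.PosDef.one (n := m) (R := ℂ))
  have h2 := Matrix.PosDef.fromBlocks₂₂ (1 : Matrix m m ℂ) H (Matrix.PosDef.one (n := n) (R := ℂ))
  rw [inv_one, Matrix.mul_one] at h1 h2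
  exact h1.1 (h2.2 h)

/-- Singular value decomposition, with the left singular vectors not normalised. -/
lemma exists_orthogonal_columns {α : Type} [Fintype α] [DecidableEq α] (M : Matrix α α ℂ) :
    ∃ (V : Matrix α α ℂ) (lam : α → ℝ), V * Vᴴ = 1 ∧ Vᴴ * V = 1 ∧ (∀ i, 0 ≤ lam i) ∧
      (M * V)ᴴ * (M * V) = diagonal fun i => (lam i : ℂ) := by
  have hP := Matrix.posSemidef_conjTranspose_mul_self M
  have hA := hP.isHermitian
  refine ⟨hA.eigenvectorUnitary, hA.eigenvalues, ?_, ?_, hP.eigenvalues_nonneg, ?_⟩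
  · exact Unitary.coe_mul_star_self hA.eigenvectorUnitary
  · exact Unitary.coe_star_mul_self hA.eigenvectorUnitary
  · have h := hA.conjStarAlgAut_star_eigenvectorUnitary
    rw [Unitary.conjStarAlgAut_star_apply] at h
    rw [conjTranspose_mul, Matrix.mul_assoc, ← Matrix.mul_assoc Mᴴ, ← Matrix.mul_assoc]
    exact h

lemma norm_trace_le_sum_sqrt {α : Type} [Fintype α] [DecidableEq α] {M V : Matrix α α ℂ}
    {lam : α → ℝ} (hV : V * Vᴴ = 1) (hV' : Vᴴ * V = 1)
    (hW : (M * V)ᴴ * (M * V) = diagonal fun i => (lam i : ℂ)) :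
    ‖M.trace‖ ≤ ∑ i, √(lam i) := by
  have hcol : ∀ (B : Matrix α α ℂ) (i : α), (Bᴴ * B) i i = ((∑ a, ‖B a i‖ ^ 2 : ℝ) : ℂ) := by
    intro B i
    rw [Matrix.mul_apply]
    push_cast
    refine Finset.sum_congr rfl fun a _ => ?_
    rw [conjTranspose_apply, Complex.star_def, Complex.conj_mul']
  have h1 : M.trace = ∑ i, ∑ a, (M * V) a i * star (V a i) := by
    have : M = (M * V) * Vᴴ := by rw [Matrix.mul_assoc, hV, Matrix.mul_one]
    conv_lhs => rw [this, Matrix.trace]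
    simp only [Matrix.diag_apply]
    rw [Finset.sum_comm]
    exact Finset.sum_congr rfl fun a _ => by rw [Matrix.mul_apply]; rfl
  rw [h1]
  refine (norm_sum_le _ _).trans (Finset.sum_le_sum fun i _ => ?_)
  have hWi : ∑ a, ‖(M * V) a i‖ ^ 2 = lam i := by
    have := hcol (M * V) i
    rw [hW, diagonal_apply_eq] at this
    exact_mod_cast this.symm
  have hVi : ∑ a, ‖V a i‖ ^ 2 = 1 := by
    have := hcol V i
    rw [hV', Matrix.one_apply_eq] at this
    exact_mod_cast this.symm
  calc ‖∑ a, (M * V) a i * star (V a i)‖ ≤ ∑ a, ‖(M * V) a i‖ * ‖V a i‖ :=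
        (norm_sum_le _ _).trans_eq (Finset.sum_congr rfl fun a _ => by rw [norm_mul, norm_star])
    _ ≤ √(∑ a, ‖(M * V) a i‖ ^ 2) * √(∑ a, ‖V a i‖ ^ 2) := Real.sum_mul_le_sqrt_mul_sqrt _ _ _
    _ = √(lam i) := by rw [hWi, hVi, Real.sqrt_one, mul_one]

/-- The matrix form of the distillation of a pure bipartite state with coefficient matrix `M`. The
first party measures the Kraus operators `X π`, the second one applies `Y π`, and branch `π` ends in
a multiple of the maximally entangled vector of rank `|β| = |α| / 2`. The total weight of these
branches is at least `N - 24 (N - G)`, where `N` is the squared norm of the state and `G` its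
overlap with the maximally entangled state of rank `|α|`. -/
lemma exists_distillation_matrices {α β : Type} [Fintype α] [DecidableEq α] [Fintype β]
    [DecidableEq β] (e : β ↪ α) (hcard : Fintype.card α = 2 * Fintype.card β)
    (hβ : 0 < Fintype.card β) (M : Matrix α α ℂ) :
    ∃ (X Y : Equiv.Perm α → Matrix β α ℂ) (q : Equiv.Perm α → ℝ),
      (1 - ∑ π, (X π)ᴴ * X π).PosSemidef ∧ (∀ π, (1 - (Y π)ᴴ * Y π).PosSemidef) ∧
      (∀ π, X π * M * (Y π)ᵀ = (q π : ℂ) • 1) ∧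
      (Mᴴ * M).trace.re - 24 * ((Mᴴ * M).trace.re - ‖M.trace‖ ^ 2 / Fintype.card α) ≤
        ∑ π, q π ^ 2 * Fintype.card β := by
  obtain ⟨V, lam, hV, hV', hlam, hW⟩ := exists_orthogonal_columns M
  have htr : (Mᴴ * M).trace.re = ∑ i, lam i := by
    have h : (Mᴴ * M).trace = ((M * V)ᴴ * (M * V)).trace := by
      rw [conjTranspose_mul, Matrix.trace_mul_comm Mᴴ, Matrix.trace_mul_comm (Vᴴ * Mᴴ),
        Matrix.mul_assoc M, ← Matrix.mul_assoc V, hV, Matrix.one_mul]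
    rw [h, hW, Matrix.trace_diagonal, ← Complex.ofReal_sum, Complex.ofReal_re]
  rw [htr]
  set G := ‖M.trace‖ ^ 2 / Fintype.card α with hG
  have hα : 0 < Fintype.card α := by omega
  have hαR : (0 : ℝ) < Fintype.card α := by exact_mod_cast hα
  have hβR : (0 : ℝ) < Fintype.card β := by exact_mod_cast hβ
  have hone : ∀ {m : Type} [Fintype m] [DecidableEq m], (1 : Matrix m m ℂ).PosSemidef :=
    Matrix.PosSemidef.one
  -- If `24 (N - G) ≥ N` the bound on the total weight is trivial and nothing is done.
  by_cases hsmall : 24 * (∑ i, lam i - G) < ∑ i, lam i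
  swap
  · refine ⟨fun _ => 0, fun _ => 0, fun _ => 0, by simpa using hone, fun _ => by simpa using hone,
      fun _ => by simp, ?_⟩
    simp only [ne_eq, OfNat.ofNat_ne_zero, not_false_eq_true, zero_pow, zero_mul,
      Finset.sum_const_zero]
    linarith
  have : Nonempty α := Fintype.card_pos_iff.1 hα
  have hGs : Fintype.card α * G ≤ (∑ i, √(lam i)) ^ 2 := by
    rw [hG, mul_div_cancel₀ _ hαR.ne']
    exact pow_le_pow_left₀ (norm_nonneg _) (norm_trace_le_sum_sqrt hV hV' hW) 2
  obtain ⟨μ, hμ0, hμlam, hμP, hP, hμK⟩ :=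
    exists_truncation lam hlam (by positivity) hGs hsmall
  set P := ∑ i, μ i with hPdef
  set K : ℝ := (Fintype.card β : ℝ) with hK
  have hαK : (Fintype.card α : ℝ) = 2 * K := by rw [hcard, hK]; push_cast; rfl
  obtain ⟨w, hw0, hw1, hw⟩ := exists_perm_weights e (by omega) hβ (fun i => K * μ i / P)
    (fun i => by have := hμ0 i; positivity)
    (fun i => by
      rw [div_le_one hP]
      have := hμK i
      rw [hαK] at this
      linarith)
    (by rw [← Finset.sum_div, ← Finset.mul_sum, ← hPdef, mul_div_assoc, div_self hP.ne', mul_one])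
  have hw' : ∀ j, ∑ π, ∑ x, (if π (e x) = j then w π * P / K else 0) = μ j := fun j => by
    have h : ∀ π x, (if π (e x) = j then w π * P / K else 0) =
        (if π (e x) = j then w π else 0) * (P / K) := fun π x => by
      split_ifs
      · rw [mul_div_assoc]
      · rw [zero_mul]
    simp only [h, ← Finset.sum_mul]
    rw [hw j]
    field_simp
  have hc0 : ∀ π, 0 ≤ w π * P / K := fun π => by have := hw0 π; positivity
  set W := M * V with hWdef
  -- The rows of `L` are dual to the orthogonal columns of `W`; the weight `w π * P / K` turns the
  -- columns picked out by `π` into vectors of equal length.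
  let L : Matrix α α ℂ := diagonal (fun i => ((lam i : ℂ))⁻¹) * Wᴴ
  have hLW : L * W = diagonal fun i => ((lam i : ℂ))⁻¹ * lam i := by
    rw [Matrix.mul_assoc, hW, diagonal_mul_diagonal]
  refine ⟨fun π => ((√(w π * P / K) : ℝ) : ℂ) • L.submatrix (π ∘ e) id,
    fun π => Vᵀ.submatrix (π ∘ e) id, fun π => √(w π * P / K), ?_, fun π => ?_, fun π => ?_, ?_⟩
  -- Summed over `π`, the selections give each column `j` the weight `μ j`.
  · let H : Matrix α α ℂ := diagonal (fun i => ((√(μ i) : ℝ) : ℂ)) * L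
    have hsq : ∀ i, ((√(μ i) : ℝ) : ℂ) * ((√(μ i) : ℝ) : ℂ) = μ i := fun i => by
      rw [← Complex.ofReal_mul, Real.mul_self_sqrt (hμ0 i)]
    have hsum : ∑ π, (((√(w π * P / K) : ℝ) : ℂ) • L.submatrix (π ∘ e) id)ᴴ *
        (((√(w π * P / K) : ℝ) : ℂ) • L.submatrix (π ∘ e) id) = Hᴴ * H := by
      ext a b
      have hl : ∀ π : Equiv.Perm α, ((((√(w π * P / K) : ℝ) : ℂ) • L.submatrix (π ∘ e) id)ᴴ *
          (((√(w π * P / K) : ℝ) : ℂ) • L.submatrix (π ∘ e) id)) a b =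
          ∑ x, ∑ j, ((if π (e x) = j then w π * P / K else 0 : ℝ) : ℂ) *
            (star (L j a) * L j b) := fun π => by
        rw [Matrix.mul_apply]
        refine Finset.sum_congr rfl fun x _ => ?_
        have hs : ((√(w π * P / K) : ℝ) : ℂ) * ((√(w π * P / K) : ℝ) : ℂ) =
            ((w π * P / K : ℝ) : ℂ) := by
          rw [← Complex.ofReal_mul, Real.mul_self_sqrt (hc0 π)]
        rw [Finset.sum_eq_single (π (e x)) (fun j _ hj => by simp [hj.symm])
          (fun h => absurd (Finset.mem_univ _) h), if_pos rfl, ← hs]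
        simp only [conjTranspose_apply, Matrix.smul_apply, submatrix_apply, Function.comp_apply,
          id_eq, smul_eq_mul, star_mul', Complex.star_def, Complex.conj_ofReal]
        ring
      rw [Matrix.sum_apply, Finset.sum_congr rfl fun π _ => hl π]
      have hcomm : ∀ F : Equiv.Perm α → β → α → ℂ,
          ∑ π, ∑ x, ∑ j, F π x j = ∑ j, ∑ π, ∑ x, F π x j := fun F => by
        rw [Finset.sum_comm' (t' := Finset.univ) (s' := fun _ => Finset.univ) (by simp)]
        rw [Finset.sum_congr rfl fun x _ => Finset.sum_comm, Finset.sum_comm]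
        exact Finset.sum_congr rfl fun j _ => Finset.sum_comm
      rw [hcomm, Matrix.mul_apply]
      refine Finset.sum_congr rfl fun j _ => ?_
      simp only [← Finset.sum_mul, ← Complex.ofReal_sum]
      rw [hw' j, ← hsq]
      simp only [H, conjTranspose_apply, diagonal_mul, star_mul', Complex.star_def,
        Complex.conj_ofReal]
      ring
    rw [hsum]
    refine posSemidef_one_sub_conjTranspose_mul H ?_
    have hHH : H * Hᴴ = diagonal fun i => ((μ i * ((lam i)⁻¹ * lam i * (lam i)⁻¹) : ℝ) : ℂ) := by
      have hLL : L * Lᴴ = diagonal fun i => ((lam i : ℂ))⁻¹ * lam i * ((lam i : ℂ))⁻¹ := by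
        have : Lᴴ = W * diagonal (fun i => ((lam i : ℂ))⁻¹) := by
          rw [conjTranspose_mul, conjTranspose_conjTranspose, diagonal_conjTranspose]
          congr 2
          ext i
          simp
        rw [this, ← Matrix.mul_assoc, hLW, diagonal_mul_diagonal]
      rw [conjTranspose_mul, Matrix.mul_assoc, ← Matrix.mul_assoc L, hLL, diagonal_conjTranspose,
        diagonal_mul_diagonal, diagonal_mul_diagonal]
      congr 1
      ext i
      simp only [Pi.star_apply, Complex.star_def, Complex.conj_ofReal]
      push_cast
      rw [← hsq]
      ring
    rw [hHH, ← diagonal_one, diagonal_sub, posSemidef_diagonal_iff]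
    intro i
    rw [← Complex.ofReal_one, ← Complex.ofReal_sub]
    refine Complex.zero_le_real.2 (sub_nonneg.2 ?_)
    rcases (hlam i).eq_or_lt with h | h
    · rw [← h]; simp
    · rw [inv_mul_cancel₀ h.ne', one_mul, ← div_eq_mul_inv, div_le_one h]
      exact hμlam i
  · refine posSemidef_one_sub_conjTranspose_mul _ ?_
    have h : Vᵀ.submatrix (π ∘ e) id * (Vᵀ.submatrix (π ∘ e) id)ᴴ = 1 := by
      have h1 : Vᵀ * (Vᵀ)ᴴ = 1 := by
        have := congrArg Matrix.transpose hV'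
        rwa [Matrix.transpose_mul, transpose_one] at this
      change (Vᵀ * (Vᵀ)ᴴ).submatrix (π ∘ e) (π ∘ e) = 1
      rw [h1, Matrix.submatrix_one _ (π.injective.comp e.injective)]
    rw [h, sub_self]
    exact Matrix.PosSemidef.zero
  · have h : L.submatrix (π ∘ e) id * M * (Vᵀ.submatrix (π ∘ e) id)ᵀ =
        (L * W).submatrix (π ∘ e) (π ∘ e) := by
      rw [hWdef, ← Matrix.mul_assoc]
      rfl
    rw [Matrix.smul_mul, Matrix.smul_mul, h, hLW,
      Matrix.submatrix_diagonal _ _ (π.injective.comp e.injective), ← diagonal_one,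
      ← diagonal_smul, ← diagonal_smul]
    congr 1
    ext x
    simp only [Pi.smul_apply, Function.comp_apply, smul_eq_mul, mul_one]
    rcases (hlam (π (e x))).eq_or_lt with h0 | h0
    -- A vanishing Schmidt coefficient is selected with weight zero, so `0⁻¹ = 0` is harmless.
    · have hμ : μ (π (e x)) = 0 := le_antisymm ((hμlam _).trans_eq h0.symm) (hμ0 _)
      have hw2 : w π = 0 := by
        refine le_antisymm ?_ (hw0 π)
        have h1 := hw (π (e x))
        rw [hμ, mul_zero, zero_div] at h1
        have hnn : ∀ π' x', 0 ≤ if π' (e x') = π (e x) then w π' else 0 := fun π' x' => by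
          split_ifs
          exacts [hw0 _, le_rfl]
        rw [← h1]
        refine le_trans ?_ (Finset.single_le_sum
          (fun π' _ => Finset.sum_nonneg fun x' _ => hnn π' x') (Finset.mem_univ π))
        refine le_trans ?_ (Finset.single_le_sum (fun x' _ => hnn π x') (Finset.mem_univ x))
        rw [if_pos rfl]
      rw [hw2]
      simp
    · rw [inv_mul_cancel₀ (by exact_mod_cast h0.ne'), mul_one]
  · refine hμP.trans (le_of_eq ?_)
    have h : ∀ π, √(w π * P / K) ^ 2 * K = w π * P := fun π => by
      rw [Real.sq_sqrt (hc0 π)]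
      field_simp
    rw [Finset.sum_congr rfl fun π _ => h π, ← Finset.sum_mul, hw1, one_mul]

/-! ### Tensor powers of pure states -/

lemma posSemidef_ketbra {ι : Type} [Fintype ι] (φ : EuclideanSpace ℂ ι) :
    (ketbra φ).PosSemidef :=
  Matrix.posSemidef_vecMulVec_self_star _

lemma IsLOCC.posSemidef_apply_ketbra {S T : System} {Λ : S.Op →ₗ[ℂ] T.Op} (hΛ : IsLOCC Λ)
    (ψ : EuclideanSpace ℂ S.Idx) : (Λ (ketbra ψ)).PosSemidef := by
  obtain ⟨J, _, φ, hφ, -⟩ := hΛ.exists_pure_branches ψ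
  rw [hφ]
  exact Matrix.posSemidef_sum _ fun j _ => posSemidef_ketbra _

lemma trace_ketbra {ι : Type} [Fintype ι] (φ : EuclideanSpace ℂ ι) :
    (ketbra φ).trace = ((‖φ‖ ^ 2 : ℝ) : ℂ) := by
  rw [EuclideanSpace.norm_sq_eq, Matrix.trace]
  push_cast
  refine Finset.sum_congr rfl fun a _ => ?_
  simp only [Matrix.diag_apply, ketbra, Matrix.of_apply, Complex.star_def, Complex.mul_conj']

/-- The vector `ψ^{⊗m}`. -/
def tensorPowVec {S : System} (ψ : EuclideanSpace ℂ S.Idx) (m : ℕ) :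
    EuclideanSpace ℂ (S.pow m).Idx :=
  WithLp.toLp 2 fun x => ∏ k : Fin m, ψ (x.1 k, x.2.1 k, x.2.2 k)

lemma tensorPow_ketbra {S : System} (ψ : EuclideanSpace ℂ S.Idx) (m : ℕ) :
    tensorPow (ketbra ψ) m = ketbra (tensorPowVec ψ m) := by
  ext x y
  simp only [tensorPow, ketbra, tensorPowVec, Matrix.of_apply, Finset.prod_mul_distrib, star_prod]

lemma trace_tensorPow {S : System} (ρ : S.Op) (m : ℕ) :
    (tensorPow ρ m).trace = ρ.trace ^ m := by
  let E : (S.pow m).Idx ≃ (Fin m → S.Idx) :=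
    { toFun := fun x k => (x.1 k, x.2.1 k, x.2.2 k)
      invFun := fun f => (fun k => (f k).1, fun k => (f k).2.1, fun k => (f k).2.2)
      left_inv := fun _ => rfl
      right_inv := fun _ => rfl }
  have h : ρ.trace ^ m = ∏ _k : Fin m, ∑ i, ρ i i := by
    rw [Finset.prod_const, Finset.card_univ, Fintype.card_fin]
    rfl
  rw [h, Finset.prod_univ_sum, Fintype.piFinset_univ, ← Equiv.sum_comp E]
  rfl

lemma tensorPowVec_eprVec_apply (n : ℕ) (x : (qubitPair.pow n).Idx) :
    tensorPowVec eprVec n x = if x.1 = x.2.1 then ((1 / √2 : ℝ) : ℂ) ^ n else 0 := by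
  change ∏ k : Fin n, (if x.1 k = x.2.1 k then ((1 / √2 : ℝ) : ℂ) else 0) = _
  split_ifs with h
  · simp [h]
  · obtain ⟨k, hk⟩ := Function.ne_iff.1 h
    exact Finset.prod_eq_zero (Finset.mem_univ k) (if_neg hk)

lemma one_div_sqrt_two_mul_self : ((1 / √2 : ℝ) : ℂ) * ((1 / √2 : ℝ) : ℂ) = 1 / 2 := by
  rw [← Complex.ofReal_mul, div_mul_div_comm, Real.mul_self_sqrt (by norm_num)]
  norm_num

lemma trace_eprAB : eprAB.trace = 1 := by
  simp only [Matrix.trace, Matrix.diag_apply, eprAB, ketbra, Matrix.of_apply, eprVec,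
    Fintype.sum_prod_type, Fin.sum_univ_two, Fin.isValue, Complex.star_def]
  simp only [Fin.isValue, Finset.univ_unique, Fin.default_eq_zero, Finset.sum_singleton, if_true,
    Complex.conj_ofReal, one_div_sqrt_two_mul_self]
  norm_num

lemma norm_eq_one_iff_trace_ketbra {ι : Type} [Fintype ι] (φ : EuclideanSpace ℂ ι) :
    ‖φ‖ = 1 ↔ (ketbra φ).trace = 1 := by
  rw [trace_ketbra, Complex.ofReal_eq_one, pow_eq_one_iff_of_nonneg (norm_nonneg _) two_ne_zero]

lemma norm_tensorPowVec {S : System} {ψ : EuclideanSpace ℂ S.Idx} (hψ : ‖ψ‖ = 1) (m : ℕ) :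
    ‖tensorPowVec ψ m‖ = 1 := by
  rw [norm_eq_one_iff_trace_ketbra] at hψ ⊢
  rw [← tensorPow_ketbra, trace_tensorPow, hψ, one_pow]

lemma norm_tensorPowVec_eprVec (n : ℕ) : ‖tensorPowVec eprVec n‖ = 1 :=
  norm_tensorPowVec ((norm_eq_one_iff_trace_ketbra _).2 trace_eprAB) n

/-! ### Fidelity with a pure state -/

lemma ketbra_mul_mul_ketbra {ι : Type} [Fintype ι] (e : EuclideanSpace ℂ ι) (σ : Matrix ι ι ℂ) :
    ketbra e * σ * ketbra e = (star e.ofLp ⬝ᵥ σ *ᵥ e.ofLp) • ketbra e := by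
  rw [ketbra_eq_vecMulVec, Matrix.mul_assoc, Matrix.mul_vecMulVec, Matrix.vecMulVec_mul_vecMulVec,
    Matrix.vecMulVec_smul]

lemma star_dotProduct_self {ι : Type} [Fintype ι] (e : EuclideanSpace ℂ ι) :
    star e.ofLp ⬝ᵥ e.ofLp = ((‖e‖ ^ 2 : ℝ) : ℂ) := by
  rw [← trace_ketbra, ketbra_eq_vecMulVec, Matrix.trace_vecMulVec, dotProduct_comm]

open scoped MatrixOrder in
lemma fidelity_ketbra {ι : Type} [Fintype ι] [DecidableEq ι] {σ : Matrix ι ι ℂ}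
    (hσ : σ.PosSemidef) {e : EuclideanSpace ℂ ι} (he : ‖e‖ = 1) :
    fidelity σ (ketbra e) = (star e.ofLp ⬝ᵥ σ *ᵥ e.ofLp).re := by
  have hE := posSemidef_ketbra e
  have hidem : ketbra e * ketbra e = ketbra e := by
    have h := ketbra_mul_mul_ketbra e 1
    rwa [Matrix.mul_one, Matrix.one_mulVec, star_dotProduct_self, he, one_pow, Complex.ofReal_one,
      one_smul] at h
  -- `√σ` is multiplied by a rank one projection, so only `⟨e, σ e⟩` survives in the trace norm.
  have hsq : CFC.sqrt (ketbra e) = ketbra e := CFC.sqrt_unique hidem hE.nonneg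
  have hc := hσ.dotProduct_mulVec_nonneg e.ofLp
  set c := star e.ofLp ⬝ᵥ σ *ᵥ e.ofLp with hcdef
  obtain ⟨hc0, hci⟩ := Complex.nonneg_iff.1 hc
  have hcr : c = (c.re : ℂ) := Complex.ext rfl hci.symm
  have hM : (CFC.sqrt σ * ketbra e)ᴴ * (CFC.sqrt σ * ketbra e) = c • ketbra e := by
    have h1 : (CFC.sqrt σ)ᴴ = CFC.sqrt σ := (CFC.sqrt_nonneg σ).posSemidef.isHermitian
    rw [conjTranspose_mul, h1, hE.isHermitian.eq, Matrix.mul_assoc, ← Matrix.mul_assoc (CFC.sqrt σ),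
      CFC.sqrt_mul_sqrt_self σ hσ.nonneg, ← Matrix.mul_assoc, ketbra_mul_mul_ketbra]
  have hroot : CFC.sqrt (c • ketbra e) = ((√c.re : ℝ) : ℂ) • ketbra e := by
    refine CFC.sqrt_unique ?_ ?_
    · rw [smul_mul_smul, hidem, ← Complex.ofReal_mul, Real.mul_self_sqrt hc0, ← hcr]
    · exact (hE.smul (Complex.zero_le_real.2 (Real.sqrt_nonneg _))).nonneg
  rw [fidelity, traceNorm, hsq, hM, hroot, Matrix.trace_smul, trace_ketbra, he]
  simp [Real.sq_sqrt hc0]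

/-! ### Exact distillation from an approximate EPR state -/

/-- The instrument with outcomes `j`, each of them with the single Kraus operator `K j`. -/
def LocalInstrument.ofOutcomes {α X κ : Type} [Fintype α] [DecidableEq α] [Fintype X]
    [DecidableEq X] [Fintype κ] (K : κ → Matrix X α ℂ)
    (hK : (1 - ∑ j, (K j)ᴴ * K j).PosSemidef) : LocalInstrument α where
  Outcome := κ
  Label _ := Unit
  Out _ := X
  K j _ := K j
  sum_le_one := by simpa using hK

lemma conjBy_conjBy {ι κ μ : Type} [Fintype ι] [Fintype κ] (A : Matrix μ κ ℂ) (B : Matrix κ ι ℂ)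
    (X : Matrix ι ι ℂ) : conjBy A (conjBy B X) = conjBy (A * B) X := by
  change A * (B * X * Matrix.conjTranspose B) * Matrix.conjTranspose A =
    (A * B) * X * Matrix.conjTranspose (A * B)
  rw [conjTranspose_mul]
  simp only [Matrix.mul_assoc]

/-- One-way communication from `A` to `B`: if `A` measures `X` and `B`, `C` react to the outcome by
`Y` and `Z`, the resulting channel is LOCC. -/
lemma exists_isLOCC_of_kraus {S T : System} {κ : Type} [Fintype κ] (X : κ → Matrix T.A S.A ℂ)
    (Y : κ → Matrix T.B S.B ℂ) (Z : Matrix T.C S.C ℂ)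
    (hX : (1 - ∑ j, (X j)ᴴ * X j).PosSemidef) (hY : ∀ j, (1 - (Y j)ᴴ * Y j).PosSemidef)
    (hZ : (1 - Zᴴ * Z).PosSemidef) :
    ∃ Γ : S.Op →ₗ[ℂ] T.Op, IsLOCC Γ ∧ ∀ ρ, Γ ρ = ∑ j, conjBy (X j ⊗ₖ (Y j ⊗ₖ Z)) ρ := by
  have hY' : ∀ j, (1 - ∑ _l : Unit, (Y j)ᴴ * Y j).PosSemidef := fun j => by simpa using hY j
  have hZ' : (1 - ∑ _l : Unit, Zᴴ * Z).PosSemidef := by simpa using hZ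
  refine ⟨_, IsLOCC.stepA (LocalInstrument.ofOutcomes X hX)
    (fun j => localC (S := (S.withA T.A).withB T.B) (fun _ : Unit => Z) ∘ₗ
      localB (S := S.withA T.A) (fun _ : Unit => Y j)) (fun j => ?_), fun ρ => ?_⟩
  · exact (isLOCC_localB (S := S.withA T.A) _ (hY' j)).comp
      (isLOCC_localC (S := (S.withA T.A).withB T.B) _ hZ')
  · rw [LinearMap.sum_apply]
    refine Finset.sum_congr rfl fun j _ => ?_
    have hA : branchA (LocalInstrument.ofOutcomes X hX) j ρ =
        conjBy (X j ⊗ₖ ((1 : Matrix S.B S.B ℂ) ⊗ₖ (1 : Matrix S.C S.C ℂ))) ρ :=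
      LinearMap.congr_fun (Fintype.sum_unique (ι := Unit) _) ρ
    have hBC : ∀ ρ', (localC (S := (S.withA T.A).withB T.B) (fun _ : Unit => Z) ∘ₗ
        localB (S := S.withA T.A) (fun _ : Unit => Y j)) ρ' =
        conjBy ((1 : Matrix T.A T.A ℂ) ⊗ₖ (Y j ⊗ₖ Z)) ρ' := fun ρ' => by
      rw [LinearMap.comp_apply, localB, localC, Fintype.sum_unique, Fintype.sum_unique,
        conjBy_conjBy, ← Matrix.mul_kronecker_mul, ← Matrix.mul_kronecker_mul]
      simp only [Matrix.mul_one, Matrix.one_mul]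
    refine (hBC _).trans ?_
    refine (congrArg (conjBy ((1 : Matrix T.A T.A ℂ) ⊗ₖ (Y j ⊗ₖ Z))) hA).trans ?_
    rw [conjBy_conjBy, ← Matrix.mul_kronecker_mul, ← Matrix.mul_kronecker_mul]
    simp only [Matrix.mul_one, Matrix.one_mul]

/-- From an unnormalised pure state with squared norm `N` and overlap `F` with `n + 1` EPR pairs,
the parties obtain exactly `n` EPR pairs with probability at least `N - 24 (N - F)`. -/
lemma exists_isLOCC_ketbra_to_epr (n : ℕ) (φ : EuclideanSpace ℂ (qubitPair.pow (n + 1)).Idx) :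
    ∃ (Γ : (qubitPair.pow (n + 1)).Op →ₗ[ℂ] (qubitPair.pow n).Op) (P : ℝ), IsLOCC Γ ∧
      Γ (ketbra φ) = (P : ℂ) • tensorPow eprAB n ∧
      (ketbra φ).trace.re - 24 * ((ketbra φ).trace.re -
        (star (tensorPowVec eprVec (n + 1)).ofLp ⬝ᵥ
          ketbra φ *ᵥ (tensorPowVec eprVec (n + 1)).ofLp).re) ≤ P := by
  let e : (Fin n → Fin 2) ↪ (Fin (n + 1) → Fin 2) := 
    ⟨fun x => Fin.cons (α := fun _ => Fin 2) 0 x, 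
      Fin.cons_right_injective (α := fun _ => Fin 2) 0⟩
  let M : Matrix (Fin (n + 1) → Fin 2) (Fin (n + 1) → Fin 2) ℂ :=
    Matrix.of fun a b => φ (a, b, fun _ => 0)
  have hcardβ : Fintype.card (Fin n → Fin 2) = 2 ^ n := by simp
  have hcardα : Fintype.card (Fin (n + 1) → Fin 2) = 2 ^ (n + 1) := by simp
  obtain ⟨X, Y, q, hX, hY, hXY, hq⟩ := exists_distillation_matrices e
    (by rw [hcardβ, hcardα, pow_succ, mul_comm]) (by rw [hcardβ]; positivity) M
  obtain ⟨Γ, hΓ, hΓρ⟩ := exists_isLOCC_of_kraus (S := qubitPair.pow (n + 1)) (T := qubitPair.pow n)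
    X Y (Matrix.of fun _ _ => 1) hX hY (by
      have h : (1 - (Matrix.of fun _ _ => 1 : Matrix (Fin n → Fin 1) (Fin (n + 1) → Fin 1) ℂ)ᴴ *
          (Matrix.of fun _ _ => 1 : Matrix (Fin n → Fin 1) (Fin (n + 1) → Fin 1) ℂ)) = 0 := by
        ext a b
        rw [Subsingleton.elim a b]
        simp [Matrix.mul_apply]
      exact h ▸ Matrix.PosSemidef.zero)
  refine ⟨Γ, ∑ π, q π ^ 2 * 2 ^ n, hΓ, ?_, ?_⟩
  · rw [hΓρ]
    push_cast
    rw [Finset.sum_smul]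
    refine Finset.sum_congr rfl fun π _ => ?_
    have hv : ∀ x : (qubitPair.pow n).Idx, (((X π) ⊗ₖ ((Y π) ⊗ₖ (Matrix.of fun _ _ => 1 :
        Matrix (Fin n → Fin 1) (Fin (n + 1) → Fin 1) ℂ))) *ᵥ φ.ofLp) x =
        if x.1 = x.2.1 then (q π : ℂ) else 0 := by
      rintro ⟨x, y, z⟩
      have h := congrFun (congrFun (hXY π) x) y
      rw [Matrix.smul_apply, Matrix.one_apply, smul_eq_mul, mul_ite, mul_one, mul_zero] at h
      rw [← h, Matrix.mulVec, dotProduct, Fintype.sum_prod_type]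
      simp only [Fintype.sum_prod_type, Fintype.sum_unique, Matrix.mul_apply, kroneckerMap_apply,
        Matrix.of_apply, mul_one, transpose_apply, Finset.sum_mul, M]
      rw [Finset.sum_comm]
      refine Finset.sum_congr rfl fun b _ => Finset.sum_congr rfl fun a _ => ?_
      rw [mul_right_comm]
      rfl
    rw [conjBy_ketbra, eprAB, tensorPow_ketbra]
    ext x y
    simp only [ketbra, Matrix.of_apply, Matrix.smul_apply, tensorPowVec_eprVec_apply, hv,
      smul_eq_mul]
    split_ifs
    · simp only [star_pow, Complex.star_def, Complex.conj_ofReal]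
      rw [← mul_pow, one_div_sqrt_two_mul_self, mul_assoc, ← mul_pow]
      norm_num
      ring
    all_goals simp
  · have hN : (ketbra φ).trace = (Mᴴ * M).trace := by
      simp only [Matrix.trace, Matrix.diag_apply, Matrix.mul_apply, Fintype.sum_prod_type,
        Fintype.sum_unique]
      rw [Finset.sum_comm]
      exact Finset.sum_congr rfl fun b _ => Finset.sum_congr rfl fun a _ => mul_comm _ _
    have hF : (star (tensorPowVec eprVec (n + 1)).ofLp ⬝ᵥ
        ketbra φ *ᵥ (tensorPowVec eprVec (n + 1)).ofLp).re = ‖M.trace‖ ^ 2 / 2 ^ (n + 1) := by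
      have h1 : star (tensorPowVec eprVec (n + 1)).ofLp ⬝ᵥ φ.ofLp =
          ((1 / √2 : ℝ) : ℂ) ^ (n + 1) * M.trace := by
        simp only [dotProduct, Pi.star_apply, tensorPowVec_eprVec_apply, Fintype.sum_prod_type,
          Fintype.sum_unique]
        rw [Matrix.trace, Finset.mul_sum]
        refine Finset.sum_congr rfl fun a _ => ?_
        rw [Finset.sum_eq_single a (fun b _ hb => by simp [hb.symm])
          (fun h => absurd (Finset.mem_univ _) h), if_pos rfl, star_pow, Complex.star_def,
          Complex.conj_ofReal]
        rfl
      have h2 : star φ.ofLp ⬝ᵥ (tensorPowVec eprVec (n + 1)).ofLp =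
          star (((1 / √2 : ℝ) : ℂ) ^ (n + 1) * M.trace) := by
        rw [← h1]
        exact star_dotProduct _ _
      rw [ketbra_eq_vecMulVec, Matrix.vecMulVec_mulVec, h2, dotProduct_smul, h1, op_smul_eq_mul,
        Complex.star_def, Complex.mul_conj', ← Complex.ofReal_pow, Complex.ofReal_re, norm_mul,
        norm_pow, mul_pow, ← pow_mul, mul_comm (n + 1), pow_mul, Complex.norm_real,
        Real.norm_eq_abs, sq_abs, div_pow, Real.sq_sqrt (by norm_num), one_pow, div_pow, one_pow]
      ring
    rw [hN, hF]
    refine le_trans (le_of_eq ?_) (hq.trans (le_of_eq ?_))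
    · rw [hcardα]; push_cast; rfl
    · rw [hcardβ]; push_cast; rfl

/-- No EPR pairs at all can be obtained with any probability: the target `EPR^{⊗0}` is the identity
of a one-dimensional space. -/
lemma transforms_tensorPow_zero {S : System} {ρ : S.Op} (hρ : ρ.trace = 1) {p : ℝ} (h0 : 0 ≤ p)
    (h1 : p ≤ 1) : Transforms ρ ((p : ℂ) • tensorPow eprAB 0) := by
  obtain ⟨Λ, hΛ, hΛt⟩ := exists_isLOCC_isTracePreserving S (qubitPair.pow 0) default
  refine ⟨_, hΛ.smul h0 h1, ?_⟩
  have hσ : Λ ρ = tensorPow eprAB 0 := by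
    have h2 : ∀ A : (qubitPair.pow 0).Op, A.trace = A default default :=
      fun A => Fintype.sum_subsingleton (fun i => A i i) default
    have h3 := hΛt ρ
    rw [hρ, h2] at h3
    have h4 := trace_tensorPow eprAB 0
    rw [pow_zero, h2] at h4
    ext x y
    rw [Subsingleton.elim x default, Subsingleton.elim y default, h3, h4]
  rw [LinearMap.smul_apply, hσ]

/-- Replacing failure by a fixed product state makes an exact probabilistic transformation
trace-preserving, with infidelity at most the failure probability. -/
lemma ApproxTransforms.of_transforms {S : System} {ψ : EuclideanSpace ℂ S.Idx}
    {n : ℕ} {p : ℝ} (h : Transforms (ketbra ψ) ((p : ℂ) • tensorPow eprAB n)) :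
    ApproxTransforms (1 - p) (ketbra ψ) (tensorPow eprAB n) := by
  obtain ⟨Λ, hΛ, hΛψ⟩ := h
  obtain ⟨Γ, hΓ, hΛΓ, hT⟩ := hΛ.exists_completion ((fun _ => 0, fun _ => 0, fun _ => 0) :
    (qubitPair.pow n).Idx)
  refine ⟨Λ + Γ, hΛΓ, hT, ?_⟩
  have hE := norm_tensorPowVec_eprVec n
  have hfid := fidelity_ketbra (hΛΓ.posSemidef_apply_ketbra ψ) hE
  rw [← tensorPow_ketbra, ← eprAB] at hfid
  rw [hfid, LinearMap.add_apply, hΛψ, Matrix.add_mulVec, dotProduct_add, Complex.add_re]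
  have h1 : star (tensorPowVec eprVec n).ofLp ⬝ᵥ
      ((p : ℂ) • tensorPow eprAB n) *ᵥ (tensorPowVec eprVec n).ofLp = p := by
    rw [eprAB, tensorPow_ketbra, ketbra_eq_vecMulVec, Matrix.smul_mulVec, Matrix.vecMulVec_mulVec,
      star_dotProduct_self, dotProduct_smul, dotProduct_smul, star_dotProduct_self, hE]
    simp
  have h2 := (Complex.nonneg_iff.1 ((hΓ.posSemidef_apply_ketbra ψ).dotProduct_mulVec_nonneg
    (tensorPowVec eprVec n).ofLp)).1
  rw [h1, Complex.ofReal_re]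
  linarith

/-- An approximate transformation with infidelity `ε` becomes an exact one with failure probability
`24 ε` if one EPR pair is sacrificed. -/
lemma ApproxTransforms.transforms {S : System} {ψ : EuclideanSpace ℂ S.Idx} (hψ : ‖ψ‖ = 1)
    {n : ℕ} {ε : ℝ} (hε : 0 ≤ ε) (hε1 : 24 * ε ≤ 1)
    (h : ApproxTransforms ε (ketbra ψ) (tensorPow eprAB n)) :
    Transforms (ketbra ψ) (((1 - 24 * ε : ℝ) : ℂ) • tensorPow eprAB (n - 1)) := by
  have htr := (norm_eq_one_iff_trace_ketbra ψ).1 hψ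
  obtain _ | n := n
  · exact transforms_tensorPow_zero htr (by linarith) (by linarith)
  obtain ⟨Λ, hΛ, hT, hF⟩ := h
  obtain ⟨J, _, φ, hφ, hJ⟩ := hΛ.exists_pure_branches ψ
  have hfid := fidelity_ketbra (hΛ.posSemidef_apply_ketbra ψ) (norm_tensorPowVec_eprVec (n + 1))
  rw [← tensorPow_ketbra, ← eprAB] at hfid
  rw [hfid] at hF
  choose Γ P hΓ hΓφ hP using fun j => exists_isLOCC_ketbra_to_epr n (φ j)
  obtain ⟨Λ', hΛ', hΛψ⟩ := hJ _ Γ hΓ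
  have hsum1 : ∑ j, (ketbra (φ j)).trace.re = 1 := by
    have h1 := hT (ketbra ψ)
    rw [htr, hφ, Matrix.trace_sum] at h1
    rw [← Complex.re_sum, h1, Complex.one_re]
  have hsumF : ∑ j, (star (tensorPowVec eprVec (n + 1)).ofLp ⬝ᵥ
      ketbra (φ j) *ᵥ (tensorPowVec eprVec (n + 1)).ofLp).re =
      (star (tensorPowVec eprVec (n + 1)).ofLp ⬝ᵥ
        Λ (ketbra ψ) *ᵥ (tensorPowVec eprVec (n + 1)).ofLp).re := by
    rw [← Complex.re_sum, ← dotProduct_sum, ← Matrix.sum_mulVec, hφ]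
  have hPsum : 1 - 24 * ε ≤ ∑ j, P j := by
    have h1 := Finset.sum_le_sum fun j (_ : j ∈ Finset.univ) => hP j
    rw [Finset.sum_sub_distrib, ← Finset.mul_sum, Finset.sum_sub_distrib, hsum1, hsumF] at h1
    linarith
  have hψ' : Λ' (ketbra ψ) = ((∑ j, P j : ℝ) : ℂ) • tensorPow eprAB n := by
    rw [hΛψ, Finset.sum_congr rfl fun j _ => hΓφ j, ← Finset.sum_smul, Complex.ofReal_sum]
  rcases (show 0 ≤ 1 - 24 * ε by linarith).eq_or_lt with h0 | h0
  · refine ⟨0, isLOCC_zero _ _, ?_⟩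
    rw [← h0]
    simp
  · have hP0 : 0 < ∑ j, P j := h0.trans_le hPsum
    refine ⟨_, hΛ'.smul (c := (1 - 24 * ε) / ∑ j, P j) (by positivity)
      ((div_le_one hP0).2 hPsum), ?_⟩
    rw [LinearMap.smul_apply, hψ', smul_smul, ← Complex.ofReal_mul, div_mul_cancel₀ _ hP0.ne']
    rfl

/-! ### Rates and exponents -/

lemma tendsto_const_div_ereal (c : ℝ) :
    Tendsto (fun m : ℕ => ((c / (m : ℝ) : ℝ) : EReal)) atTop (nhds 0) := by
  exact (continuous_coe_real_ereal.tendsto 0).comp (tendsto_const_div_atTop_nhds_zero_nat c)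

/-- A constant factor does not change the exponent of decay. -/
lemma le_liminf_exponent_const_mul {ε : ℕ → ℝ} (hε : ∀ m, 0 < ε m) {c : ℝ} (hc : 0 < c) {r : EReal}
    (h : r ≤ liminf (fun m : ℕ => ((-(1 / (m : ℝ)) * Real.logb 2 (ε m) : ℝ) : EReal)) atTop) :
    r ≤ liminf (fun m : ℕ => ((-(1 / (m : ℝ)) * Real.logb 2 (c * ε m) : ℝ) : EReal)) atTop := by
  have h1 := (tendsto_const_div_ereal (-Real.logb 2 c)).liminf_eq
  have h2 := EReal.le_liminf_add (f := atTop)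
    (u := fun m : ℕ => ((-Real.logb 2 c / (m : ℝ) : ℝ) : EReal))
    (v := fun m : ℕ => ((-(1 / (m : ℝ)) * Real.logb 2 (ε m) : ℝ) : EReal))
  rw [h1, zero_add] at h2
  refine (h.trans h2).trans_eq (congrArg (fun f => liminf f atTop) (funext fun m => ?_))
  rw [Pi.add_apply, ← EReal.coe_add, Real.logb_mul hc.ne' (hε m).ne']
  congr 1
  ring

lemma eventually_lt_of_exponent_pos {ε : ℕ → ℝ} (hε : ∀ m, 0 < ε m) {r : ℝ} (hr : 0 < r)
    (h : (r : EReal) ≤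
      liminf (fun m : ℕ => ((-(1 / (m : ℝ)) * Real.logb 2 (ε m) : ℝ) : EReal)) atTop)
    {δ : ℝ} (hδ : 0 < δ) : ∀ᶠ m in atTop, ε m < δ := by
  have h1 : ((r / 2 : ℝ) : EReal) <
      liminf (fun m : ℕ => ((-(1 / (m : ℝ)) * Real.logb 2 (ε m) : ℝ) : EReal)) atTop :=
    (EReal.coe_lt_coe_iff.2 (half_lt_self hr)).trans_le h
  have h2 : ∀ᶠ m : ℕ in atTop, -Real.logb 2 δ < r / 2 * (m : ℝ) :=
    (tendsto_natCast_atTop_atTop.const_mul_atTop (half_pos hr)).eventually_gt_atTop _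
  filter_upwards [eventually_lt_of_lt_liminf h1, h2, eventually_gt_atTop 0] with m hm1 hm2 hm0
  have hm0' : (0 : ℝ) < m := by exact_mod_cast hm0
  have h3 := EReal.coe_lt_coe_iff.1 hm1
  rw [neg_mul, one_div, inv_mul_eq_div, ← neg_div, lt_div_iff₀ hm0'] at h3
  exact (Real.logb_lt_logb_iff one_lt_two (hε m) hδ).1 (by linarith)

/-- Giving up one copy does not change the rate. -/
lemma limsup_pred_div (n : ℕ → ℕ) :
    limsup (fun m : ℕ => (((n m : ℝ) / (m : ℝ) : ℝ) : EReal)) atTop =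
      limsup (fun m : ℕ => ((((n m - 1 : ℕ) : ℝ) / (m : ℝ) : ℝ) : EReal)) atTop := by
  apply le_antisymm
  · have h1 := (tendsto_const_div_ereal 1).limsup_eq
    have h2 := EReal.limsup_add_le (f := atTop)
      (u := fun m : ℕ => ((((n m - 1 : ℕ) : ℝ) / (m : ℝ) : ℝ) : EReal))
      (v := fun m : ℕ => ((1 / (m : ℝ) : ℝ) : EReal))
      (Or.inr (by rw [h1]; exact EReal.zero_ne_top)) (Or.inr (by rw [h1]; exact EReal.zero_ne_bot))
    rw [h1, add_zero] at h2
    refine (limsup_le_limsup (Eventually.of_forall fun m => ?_)).trans h2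
    rw [Pi.add_apply, ← EReal.coe_add, EReal.coe_le_coe_iff, ← add_div]
    gcongr
    exact_mod_cast (show n m ≤ n m - 1 + 1 by omega)
  · refine limsup_le_limsup (Eventually.of_forall fun m => ?_)
    rw [EReal.coe_le_coe_iff]
    gcongr
    exact_mod_cast Nat.sub_le _ _

end EPRDistill

end

theorem mainTheorem7 (S : EPRDistill.System) (ψ : EuclideanSpace ℂ S.Idx) (hψ : ‖ψ‖ = 1)
    (r : ℝ) (hr : 0 < r) :
    EPRDistill.directRate (EPRDistill.ketbra ψ) EPRDistill.eprAB r
      = EPRDistill.directRateFidelity (EPRDistill.ketbra ψ) EPRDistill.eprAB r := by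
  have hψm : ∀ m, ‖EPRDistill.tensorPowVec ψ m‖ = 1 := EPRDistill.norm_tensorPowVec hψ
  apply le_antisymm
  · apply sSup_le_sSup
    rintro x ⟨n, p, hp, hrate, htrans, rfl⟩
    refine ⟨n, fun m => 1 - p m, fun m => ⟨by linarith [(hp m).2], by linarith [(hp m).1]⟩, hrate,
      fun m => ?_, rfl⟩
    have h := htrans m
    rw [EPRDistill.tensorPow_ketbra] at h ⊢
    exact EPRDistill.ApproxTransforms.of_transforms h
  · apply sSup_le_sSup
    rintro x ⟨n, ε, hε, hrate, happrox, rfl⟩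
    have hev : ∀ᶠ m in Filter.atTop, ε m < 1 / 24 :=
      EPRDistill.eventually_lt_of_exponent_pos (fun m => (hε m).1) hr hrate (by norm_num)
    -- Only finitely many `m` have `24 * ε m ≥ 1`; for those no EPR pair is distilled.
    have hchoice : ∀ m, ∃ (k : ℕ) (p : ℝ), (0 < p ∧ p < 1) ∧
        EPRDistill.Transforms (EPRDistill.tensorPow (EPRDistill.ketbra ψ) m)
          ((p : ℂ) • EPRDistill.tensorPow EPRDistill.eprAB k) ∧
        (ε m < 1 / 24 → k = n m - 1 ∧ p = 1 - 24 * ε m) := fun m => by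
      have h := happrox m
      rw [EPRDistill.tensorPow_ketbra] at h ⊢
      by_cases hm : ε m < 1 / 24
      · exact ⟨n m - 1, 1 - 24 * ε m, ⟨by linarith, by linarith [(hε m).1]⟩,
          h.transforms (hψm m) (hε m).1.le (by linarith), fun _ => ⟨rfl, rfl⟩⟩
      · exact ⟨0, 1 / 2, by norm_num, EPRDistill.transforms_tensorPow_zero
          ((EPRDistill.norm_eq_one_iff_trace_ketbra _).1 (hψm m)) (by norm_num) (by norm_num),
          fun h => absurd h hm⟩
    choose k p hp htrans hkp using hchoice
    refine ⟨k, p, hp, ?_, htrans, ?_⟩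
    · refine (EPRDistill.le_liminf_exponent_const_mul (fun m => (hε m).1)
        (show (0 : ℝ) < 24 by norm_num) hrate).trans_eq (Filter.liminf_congr ?_)
      filter_upwards [hev] with m hm
      rw [(hkp m hm).2, sub_sub_cancel]
    · rw [EPRDistill.limsup_pred_div]
      refine Filter.limsup_congr ?_
      filter_upwards [hev] with m hm
      rw [(hkp m hm).1]
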